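/- **Model.** Base stations (BSs) form a homogeneous Poisson point process $\Phi=\{b_i\}$ of density $\lambda>0$ on the plane; active users have density $\rho\in(0,\infty)$; the typical user is at the origin. The set of active BSs $\tilde\Phi\subseteq\Phi$ is modelled as a homogeneous Poisson process of density $$\tilde\lambda=\lambda\Bigl[1-\bigl(1+\tfrac{\rho}{q\lambda}\bigr)^{-q}\Bigr],\qquad q>0,$$ with no further restriction on the joint law of $(\Phi,\tilde\Phi)$. A BS at planar distance $r$ has 3D distance $w=\sqrt{r^2+L^2}$. Let $L<d_1<\dots<d_{N-1}$, $N\ge1$, and call $w$ in piece $n$ if $d_{n-1}<w\le d_n$ (piece $1$: $L\le w\le d_1$; piece $N$: $w>d_{N-1}$). In piece $n$ the link is line-of-sight (LoS) with probability $\mathrm{Pr}^{\rm L}(w)=\mathrm{Pr}^{\rm L}_n(w)\in[0,1]$, with path loss gain $\zeta^{\rm L}(w)=A^{\rm L}_nw^{-\alpha^{\rm L}_n}$, and otherwise has gain $\zeta^{\rm NL}(w)=A^{\rm NL}_nw^{-\alpha^{\rm NL}_n}$; all $A$'s and $\alpha$'s are positive and each $\mathrm{Pr}^{\rm L}_n$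 is monotonically decreasing (not necessarily strictly) on its piece. Assume $\mathrm{Pr}^{\rm L}_1(w)>0$ for some $w>L$ in the first piece, and that, with $\zeta_1^{\rm L}(L)=A_1^{\rm L}L^{-\alpha_1^{\rm L}}$, $\zeta^{\rm L}(w)\le\zeta_1^{\rm L}(L)$ and $\zeta^{\rm NL}(w)\le\zeta_1^{\rm L}(L)$ for all $w\ge L$ (no link is stronger than a LoS link of minimal length). LoS indicators are conditionally independent given $(\Phi,\tilde\Phi)$. The typical user is served by the BS $b_o\in\Phi$ with the largest gain $\zeta_o$. With i.i.d. mean-one exponential fadings $h,g_1,g_2,\dots$ independent of everything else, transmit power $P>0$, noise power $P_{\rm N}>0$, and $\beta_i$ the gain of the link from $b_i$, $$\mathrm{SINR}=\frac{P\zeta_oh}{\sum_{b_i\in\tilde\Phi\setminus\{b_o\}}P\beta_ig_i+P_{\rm N}}$$ (which is $0$ if the sum diverges). Let $p^{\rm cov}(\lambda,\rho,\gamma)=\Pr[\mathrm{SINR}>\gamma]$ and, with $f_\Gamma$ the probability density function of the SINR (on $(0,\infty)$), let $$A^{\rm ASE}(\lambda,\rho,\gamma_0)=\tilde\lambda\int_{\gamma_0}^\infty\log_2(1+\gamma)f_\Gamma(\lambda,\rho,\gamma)\,d\gamma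 .$$ **Theorem (constant capacity scaling law).** Let $L>0$, $0<\rho<\infty$ and $\gamma_0\ge0$. Then $\tilde\lambda\to\rho$ as $\lambda\to\infty$, and for every $\gamma>0$ $$\lim_{\lambda\to\infty}p^{\rm cov}(\lambda,\rho,\gamma)=p^\infty(\gamma):=e^{-\frac{P_{\rm N}\gamma}{P\zeta_1^{\rm L}(L)}}\exp\Bigl(-2\pi\rho\int_0^\infty\frac{\mathrm{Pr}^{\rm L}(w_u)\,u}{1+(sP\zeta^{\rm L}(w_u))^{-1}}du\Bigr)\exp\Bigl(-2\pi\rho\int_0^\infty\frac{[1-\mathrm{Pr}^{\rm L}(w_u)]\,u}{1+(sP\zeta^{\rm NL}(w_u))^{-1}}du\Bigr),$$ where $w_u=\sqrt{u^2+L^2}$, $s=\gamma/(P\zeta_1^{\rm L}(L))$ and $\exp(-\infty)=0$. The integral in the limit below and the one defining $A^{\rm ASE}$ (for every $\lambda>0$) converge, and the area spectral efficiency tends to a constant independent of $\lambda$: $$\lim_{\lambda\to\infty}A^{\rm ASE}(\lambda,\rho,\gamma_0)=\frac{\rho}{\ln2}\int_{\gamma_0}^\infty\frac{p^\infty(\gamma)}{1+\gamma}\,d\gamma+\rho\log_2(1+\gamma_0)\,p^\infty(\gamma_0)$$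 (the last term is $0$ if $\gamma_0=0$). -/

import Mathlib

open MeasureTheory ProbabilityTheory Filter Topology
open scoped ENNReal

noncomputable section

/-- The plane in which base stations (BSs) are deployed; the typical user (UE) sits at the origin. -/
abbrev Plane : Type := EuclideanSpace ℝ (Fin 2)

/-- Parameters of the radio model. There are `m + 1` pieces, separated by the break points
`d 0 < … < d (m - 1)`; the piece with index `n` (counted from `0`) has LoS gain
`AL n * w ^ (-αL n)`, NLoS gain `ANL n * w ^ (-αNL n)` and LoS probability `PrL n w`, where `w` is
the 3D distance. `L` is the antenna height difference, `P` the transmission power, `PN` the noise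
power and `q` the shape parameter in the density of active BSs. -/
structure RadioModel where
  m : ℕ
  d : Fin m → ℝ
  AL : Fin (m + 1) → ℝ
  ANL : Fin (m + 1) → ℝ
  αL : Fin (m + 1) → ℝ
  αNL : Fin (m + 1) → ℝ
  PrL : Fin (m + 1) → ℝ → ℝ
  L : ℝ
  P : ℝ
  PN : ℝ
  q : ℝ

namespace RadioModel

variable (M : RadioModel)

/-- The index of the piece that contains the distance `w`, i.e. the number of break points that are
strictly smaller than `w`: index `0` for `w ≤ d 0`, index `1` for `d 0 < w ≤ d 1`, and so on. -/
def piece (w : ℝ) : Fin (M.m + 1) :=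
  ⟨(Finset.univ.filter (fun i : Fin M.m => M.d i < w)).card,
    Nat.lt_succ_of_le ((Finset.card_le_univ _).trans (Fintype.card_fin M.m).le)⟩

/-- Piecewise LoS path loss function (a power gain). -/
def gainL (w : ℝ) : ℝ := M.AL (M.piece w) * w ^ (-M.αL (M.piece w))

/-- Piecewise NLoS path loss function (a power gain). -/
def gainNL (w : ℝ) : ℝ := M.ANL (M.piece w) * w ^ (-M.αNL (M.piece w))

/-- Piecewise LoS probability function. -/
def prLoS (w : ℝ) : ℝ := M.PrL (M.piece w) w

/-- First-piece LoS gain at the minimal possible 3D distance `L`. -/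
def peakGain : ℝ := M.AL 0 * M.L ^ (-M.αL 0)

/-- 3D distance for the 2D distance `r`. -/
def dist3 (r : ℝ) : ℝ := Real.sqrt (r ^ 2 + M.L ^ 2)

/-- Standing conditions on the parameters. -/
structure Admissible : Prop where
  d_mono : StrictMono M.d
  L_lt_d : ∀ i, M.L < M.d i
  AL_pos : ∀ n, 0 < M.AL n
  ANL_pos : ∀ n, 0 < M.ANL n
  αL_pos : ∀ n, 0 < M.αL n
  αNL_pos : ∀ n, 0 < M.αNL n
  P_pos : 0 < M.P
  PN_pos : 0 < M.PN
  q_pos : 0 < M.q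
  /-- LoS probabilities are probabilities, on all possible distances. -/
  prLoS_mem : ∀ w, M.L ≤ w → M.prLoS w ∈ Set.Icc (0 : ℝ) 1
  /-- Every piece of the LoS probability function is monotonically decreasing. -/
  PrL_anti : ∀ n, AntitoneOn (M.PrL n) {w | M.L ≤ w ∧ M.piece w = n}
  /-- LoS links exist at short distances (automatic if the first piece of the LoS probability
  function is strictly decreasing). -/
  PrL_pos : ∃ w, M.L < w ∧ M.piece w = 0 ∧ 0 < M.PrL 0 w
  /-- No link is stronger than a LoS link of minimal length. -/
  gainL_le : ∀ w, M.L ≤ w → M.gainL w ≤ M.peakGain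
  gainNL_le : ∀ w, M.L ≤ w → M.gainNL w ≤ M.peakGain

/-- Density of active BSs, `l` being the density of BSs and `ρ` the density of UEs. -/
def activeDensity (ρ l : ℝ) : ℝ := l * (1 - 1 / (1 + ρ / (M.q * l)) ^ M.q)

/-- `exp (-x)` for `x ∈ [0, ∞]`, with `exp (-∞) = 0`. -/
def expNeg (x : ℝ≥0∞) : ℝ := if x = ∞ then 0 else Real.exp (-x.toReal)

/-- The integral `∫₀^∞ p(w) u / (1 + (s P ζ(w))⁻¹) du` with `w = √(u² + L²)`, as an element of
`[0, ∞]`. The fraction `1 / (1 + x⁻¹)` is written as `x / (1 + x)`, so that it is `0` at `x = 0`. -/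
def interfIntegral (p ζ : ℝ → ℝ) (s : ℝ) : ℝ≥0∞ :=
  ∫⁻ u in Set.Ioi (0 : ℝ), ENNReal.ofReal
    (p (M.dist3 u) * u * (s * M.P * ζ (M.dist3 u) / (1 + s * M.P * ζ (M.dist3 u))))

/-- The limit of the Laplace transform of the aggregate interference. -/
def laplaceLimit (ρ s : ℝ) : ℝ :=
  expNeg (ENNReal.ofReal (2 * Real.pi * ρ) * M.interfIntegral M.prLoS M.gainL s) *
    expNeg (ENNReal.ofReal (2 * Real.pi * ρ) *
      M.interfIntegral (fun w => 1 - M.prLoS w) M.gainNL s)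

/-- The limiting coverage probability. -/
def coverageLimit (ρ γ : ℝ) : ℝ :=
  Real.exp (-(M.PN * γ / (M.P * M.peakGain))) * M.laplaceLimit ρ (γ / (M.P * M.peakGain))

end RadioModel

section PointProcess

variable {Ω : Type*} [MeasurableSpace Ω]

/-- Number of selected points in `B`. -/
def pointCount (b : ℕ → Ω → Plane) (sel : ℕ → Ω → Bool) (B : Set Plane) (ω : Ω) : ℕ∞ :=
  {i | sel i ω = true ∧ b i ω ∈ B}.encard

/-- The selected points form a homogeneous Poisson point process with density `dens`. -/
structure IsHPPP (μ : Measure Ω) (b : ℕ → Ω → Plane) (sel : ℕ → Ω → Bool) (dens : ℝ) : Prop where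
  poisson : ∀ B : Set Plane, MeasurableSet B → volume B ≠ ∞ → ∀ k : ℕ,
    μ {ω | pointCount b sel B ω = k} =
      poissonMeasure (dens * (volume B).toReal).toNNReal {k}
  indep : ∀ (n : ℕ) (B : Fin n → Set Plane), (∀ j, MeasurableSet (B j)) →
    Pairwise (fun j k => Disjoint (B j) (B k)) →
      iIndepFun (fun j => pointCount b sel (B j)) μ

end PointProcess

/-- The random variables of a network: `pos i` is the position of the `i`-th BS, `active i` tells
whether it is active, `mark i` is the uniform variable that decides whether its link to the typical
UE is LoS, `g i` is the fading of that link if it interferes, and `h` is the fading of the serving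
link. -/
structure Network (Ω : Type*) where
  pos : ℕ → Ω → Plane
  active : ℕ → Ω → Bool
  mark : ℕ → Ω → ℝ
  g : ℕ → Ω → ℝ
  h : Ω → ℝ

namespace Network

variable {Ω : Type*} (X : Network Ω) (M : RadioModel)

/-- 3D distance of the `i`-th BS from the typical UE at the origin. -/
def linkDist (i : ℕ) (ω : Ω) : ℝ := M.dist3 ‖X.pos i ω‖

/-- Path loss of the link from the `i`-th BS; the link is LoS with probability `prLoS` of its
length. -/
def gain (i : ℕ) (ω : Ω) : ℝ :=
  if X.mark i ω ≤ M.prLoS (X.linkDist M i ω) then M.gainL (X.linkDist M i ω)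
  else M.gainNL (X.linkDist M i ω)

/-- Index of the serving BS: the one with the largest path loss gain, i.e. with the maximum average
received signal strength (the first one in case of a tie). -/
def serving (ω : Ω) : ℕ := sInf {i | ∀ j, X.gain M j ω ≤ X.gain M i ω}

/-- Aggregate interference from the active BSs other than the serving one, in `[0, ∞]`. -/
def interference (ω : Ω) : ℝ≥0∞ :=
  ∑' i, if X.active i ω = true ∧ i ≠ X.serving M ω then
    ENNReal.ofReal (M.P * X.gain M i ω * X.g i ω) else 0

/-- The SINR of the typical UE (`0` if the interference is infinite). -/
def sinr (ω : Ω) : ℝ :=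
  (ENNReal.ofReal (M.P * X.gain M (X.serving M ω) ω * X.h ω) /
    (X.interference M ω + ENNReal.ofReal M.PN)).toReal

variable [MeasurableSpace Ω]

/-- `X` is a network with BS density `l` and UE density `ρ`, on the probability space `(Ω, μ)`. -/
structure IsModel (μ : Measure Ω) (l ρ : ℝ) : Prop where
  meas_pos : ∀ i, Measurable (X.pos i)
  meas_active : ∀ i, Measurable (X.active i)
  meas_mark : ∀ i, Measurable (X.mark i)
  meas_g : ∀ i, Measurable (X.g i)
  meas_h : Measurable X.h
  /-- All BSs form a Poisson process with density `l`. -/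
  bs_hppp : IsHPPP μ X.pos (fun _ _ => true) l
  /-- The active BSs form a Poisson process with density `activeDensity`. -/
  active_hppp : IsHPPP μ X.pos X.active (M.activeDensity ρ l)
  mark_law : ∀ i, μ.map (X.mark i) = volume.restrict (Set.Icc (0 : ℝ) 1)
  mark_indep : iIndepFun X.mark μ
  /-- Rayleigh fading: power gains are exponential with mean one. -/
  g_law : ∀ i, μ.map (X.g i) = expMeasure 1
  g_indep : iIndepFun X.g μ
  h_law : μ.map X.h = expMeasure 1
  /-- The BS process (with activity), the LoS marks, the interfering fadings and the serving fading
  are independent of each other. -/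
  indep_bs : IndepFun (fun ω i => (X.pos i ω, X.active i ω))
    (fun ω => ((fun i => X.mark i ω), (fun i => X.g i ω), X.h ω)) μ
  indep_mark : IndepFun (fun ω i => X.mark i ω) (fun ω => ((fun i => X.g i ω), X.h ω)) μ
  indep_fading : IndepFun (fun ω i => X.g i ω) X.h μ

/-- Coverage probability of the typical UE. -/
def coverage (μ : Measure Ω) (γ : ℝ) : ℝ := μ.real {ω | γ < X.sinr M ω}

/-- The integrand `log₂(1 + γ) f(γ)` of the area spectral efficiency, where `f` is the probability
density function of the SINR. -/
def rateDensity (μ : Measure Ω) (γ : ℝ) : ℝ :=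
  Real.logb 2 (1 + γ) * (pdf (X.sinr M) μ volume γ).toReal

/-- Area spectral efficiency for BS density `l`, UE density `ρ` and minimum working SINR `γ₀`. -/
def ase (μ : Measure Ω) (l ρ γ₀ : ℝ) : ℝ :=
  M.activeDensity ρ l * ∫ γ in Set.Ioi γ₀, X.rateDensity M μ γ

end Network

end

/-! As the BS density grows, BSs crowd around the user while the density of active BSs stays near
`ρ`. Fix `t` slightly below `peakGain`. A link of gain at least `t` must start in `strongSet t`, a
planar set whose area shrinks to `0` as `t` increases to `peakGain` (`tendsto_volume_strongSet`).
Near the origin there is a disc where LoS links reach gain `t` and LoS has probability bounded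
below, so for large `l` some BS has gain at least `t`. With probability close to `1` no active BS
lies in `strongSet t`. Off a `badEvent` the serving gain is therefore in `[t, peakGain]` and the
serving BS is inactive, so the interference is the shot noise of the whole active process
(`gain_serving_of_notMem_badEvent`). Only a union bound over the two marginal Poisson laws is used,
hence no assumption on their joint law is needed.

Given everything but `h`, coverage has probability `exp (-γ * load)` (`measure_lt_sinr`). The shot
noise has an explicit Laplace transform: average over fadings, then over marks, then apply the
probability generating functional of the active process (`lintegral_nexp_totalInterference`).
Bounding the serving gain by `peakGain` or by `t` sandwiches the coverage probability; letting `l →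
∞` first and `t → peakGain` second gives the limit. Since the Laplace exponent at `c * s` is at most
`c` times that at `s` for `c ≥ 1`, no continuity in `s` is needed, and an infinite exponent requires
no separate case.

For the area spectral efficiency, the layer cake formula turns the integral against the density into
one of `coverage / (1 + γ)` plus a boundary term. Noise alone bounds coverage by `exp (-c * γ)`
uniformly in `l`, so dominated convergence applies. -/

/-! ### Exponentials on `[0, ∞]` and infinite products. -/

/-- The function `exp (-x)` on `[0, ∞]`, with values in `[0, ∞]`. -/
noncomputable def nexp (x : ℝ≥0∞) : ℝ≥0∞ := EReal.exp (-(x : EReal))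

lemma nexp_zero : nexp 0 = 1 := by simp [nexp]

lemma nexp_top : nexp ∞ = 0 := by simp [nexp]

lemma nexp_antitone : Antitone nexp := fun _ _ h =>
  EReal.exp_monotone (EReal.neg_le_neg_iff.2 (EReal.coe_ennreal_le_coe_ennreal_iff.2 h))

lemma continuous_nexp : Continuous nexp :=
  ENNReal.continuous_exp.comp (continuous_neg.comp continuous_coe_ennreal_ereal)

lemma measurable_nexp : Measurable nexp := continuous_nexp.measurable

lemma nexp_le_one (x : ℝ≥0∞) : nexp x ≤ 1 := nexp_zero ▸ nexp_antitone zero_le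

lemma nexp_ne_top (x : ℝ≥0∞) : nexp x ≠ ∞ := ((nexp_le_one x).trans_lt ENNReal.one_lt_top).ne

lemma nexp_add (x y : ℝ≥0∞) : nexp (x + y) = nexp x * nexp y := by
  unfold nexp
  rw [EReal.coe_ennreal_add, EReal.neg_add (by simp) (by simp), sub_eq_add_neg, EReal.exp_add]

lemma nexp_ofReal {x : ℝ} (hx : 0 ≤ x) : nexp (ENNReal.ofReal x) = ENNReal.ofReal (Real.exp (-x)) := by
  unfold nexp
  rw [EReal.coe_ennreal_ofReal, max_eq_left hx, ← EReal.coe_neg, EReal.exp_coe]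

lemma nexp_eq_ofReal {x : ℝ≥0∞} (hx : x ≠ ∞) : nexp x = ENNReal.ofReal (Real.exp (-x.toReal)) := by
  rw [← nexp_ofReal ENNReal.toReal_nonneg, ENNReal.ofReal_toReal hx]

lemma nexp_natCast_mul (n : ℕ) (x : ℝ≥0∞) : nexp (n * x) = nexp x ^ n := by
  induction n with
  | zero => simp [nexp_zero]
  | succ n ih => rw [Nat.cast_succ, add_mul, one_mul, nexp_add, ih, pow_succ]

lemma nexp_sum {ι : Type*} (s : Finset ι) (a : ι → ℝ≥0∞) :
    nexp (∑ i ∈ s, a i) = ∏ i ∈ s, nexp (a i) := by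
  classical
  induction s using Finset.induction_on with
  | empty => simp [nexp_zero]
  | insert i s hi ih => rw [Finset.sum_insert hi, Finset.prod_insert hi, nexp_add, ih]

lemma expNeg_eq_toReal_nexp (x : ℝ≥0∞) : RadioModel.expNeg x = (nexp x).toReal := by
  unfold RadioModel.expNeg
  split_ifs with h
  · simp [h, nexp_top]
  · rw [nexp_eq_ofReal h, ENNReal.toReal_ofReal (Real.exp_pos _).le]

/-- A right inverse of `nexp` on `[0, 1]`. -/
noncomputable def nlog (v : ℝ≥0∞) : ℝ≥0∞ := (-(ENNReal.log v)).toENNReal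

lemma nexp_nlog {v : ℝ≥0∞} (hv : v ≤ 1) : nexp (nlog v) = v := by
  have h : 0 ≤ -(ENNReal.log v) := by
    have := ENNReal.logOrderIso.monotone hv
    simpa [EReal.neg_nonneg] using this
  rw [nexp, nlog, EReal.coe_toENNReal h, neg_neg, ENNReal.exp_log]

lemma measurable_nlog : Measurable nlog := by
  unfold nlog
  exact (ENNReal.measurable_log.neg).ereal_toENNReal

/-- The infinite product of a sequence with values in `[0, 1]`. -/
noncomputable def infProd (a : ℕ → ℝ≥0∞) : ℝ≥0∞ := ⨅ n, ∏ i ∈ Finset.range n, a i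

lemma antitone_prod_range {a : ℕ → ℝ≥0∞} (ha : ∀ i, a i ≤ 1) :
    Antitone fun n => ∏ i ∈ Finset.range n, a i :=
  antitone_nat_of_succ_le fun n => by
    rw [Finset.prod_range_succ]
    exact mul_le_of_le_one_right zero_le (ha n)

/-- Continuity of `nexp` includes the point `∞`, so divergent sums are covered: the product is then
`0`. -/
lemma nexp_tsum (a : ℕ → ℝ≥0∞) : nexp (∑' i, a i) = infProd fun i => nexp (a i) := by
  have h1 : Tendsto (fun n => nexp (∑ i ∈ Finset.range n, a i)) atTop (𝓝 (nexp (∑' i, a i))) :=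
    (continuous_nexp.tendsto _).comp (ENNReal.summable.hasSum.tendsto_sum_nat)
  have h2 := tendsto_atTop_iInf (antitone_prod_range fun i => nexp_le_one (a i))
  simp only [nexp_sum] at h1
  exact tendsto_nhds_unique h1 h2

section

variable {Ω S T : Type*} [MeasurableSpace Ω] [MeasurableSpace S] [MeasurableSpace T]

lemma lintegral_infProd {μ : Measure Ω} [IsProbabilityMeasure μ] {a : ℕ → Ω → ℝ≥0∞}
    (ha : ∀ i, Measurable (a i)) (ha1 : ∀ i ω, a i ω ≤ 1) :
    ∫⁻ ω, infProd (fun i => a i ω) ∂μ = ⨅ n, ∫⁻ ω, ∏ i ∈ Finset.range n, a i ω ∂μ := by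
  unfold infProd
  refine lintegral_iInf (fun n => Finset.measurable_fun_prod _ fun i _ => ha i)
    (fun m n h ω => antitone_prod_range (fun i => ha1 i ω) h) ?_
  simp

/-- Conditionally on `U` the factors are independent, so each may be averaged separately. Partial
products decrease, which reduces the claim to finite products, where Fubini and independence of the
`Y i` apply. It serves both for integrating out fadings and for integrating out marks. -/
lemma lintegral_infProd_of_indep {μ : Measure Ω} [IsProbabilityMeasure μ] {U : Ω → S}
    {Y : ℕ → Ω → T} (hU : Measurable U) (hY : ∀ i, Measurable (Y i)) (hYi : iIndepFun Y μ)
    (hUY : IndepFun U (fun ω i => Y i ω) μ) {F : ℕ → S → T → ℝ≥0∞}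
    (hF : ∀ i, Measurable (Function.uncurry (F i))) (hF1 : ∀ i s t, F i s t ≤ 1) :
    ∫⁻ ω, infProd (fun i => F i (U ω) (Y i ω)) ∂μ =
      ∫⁻ ω, infProd (fun i => ∫⁻ ω', F i (U ω) (Y i ω') ∂μ) ∂μ := by
  have hYm : Measurable fun ω i => Y i ω := measurable_pi_lambda _ hY
  have hF' : ∀ i, Measurable fun p : S × Ω => F i p.1 (Y i p.2) := fun i =>
    (hF i).comp (measurable_fst.prodMk ((hY i).comp measurable_snd))
  rw [lintegral_infProd (a := fun i ω => F i (U ω) (Y i ω))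
      (fun i => (hF i).comp (hU.prodMk (hY i))) (fun i ω => hF1 i _ _),
    lintegral_infProd (a := fun i ω => ∫⁻ ω', F i (U ω) (Y i ω') ∂μ)
      (fun i => ((hF' i).lintegral_prod_right').comp hU)
      (fun i ω => (lintegral_mono fun ω' => hF1 i _ _).trans (by simp))]
  congr 1
  ext n
  have hG : Measurable fun p : S × (ℕ → T) => ∏ i ∈ Finset.range n, F i p.1 (p.2 i) :=
    Finset.measurable_fun_prod _ fun i _ =>
      (hF i).comp (measurable_fst.prodMk ((measurable_pi_apply i).comp measurable_snd))
  have hmap := hUY.map_prod_eq_prod_map_map hU.aemeasurable hYm.aemeasurable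
  calc ∫⁻ ω, ∏ i ∈ Finset.range n, F i (U ω) (Y i ω) ∂μ
      = ∫⁻ p, ∏ i ∈ Finset.range n, F i p.1 (p.2 i) ∂(μ.map fun ω => (U ω, fun i => Y i ω)) :=
        (lintegral_map hG (hU.prodMk hYm)).symm
    _ = ∫⁻ s, ∫⁻ y, ∏ i ∈ Finset.range n, F i s (y i) ∂(μ.map fun ω i => Y i ω) ∂(μ.map U) := by
        have := Measure.isProbabilityMeasure_map (μ := μ) hYm.aemeasurable
        rw [hmap, lintegral_prod _ hG.aemeasurable]
    _ = ∫⁻ s, ∏ i ∈ Finset.range n, ∫⁻ ω', F i s (Y i ω') ∂μ ∂(μ.map U) := by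
        refine lintegral_congr fun s => ?_
        rw [lintegral_map (f := fun y : ℕ → T => ∏ i ∈ Finset.range n, F i s (y i))
          (hG.comp measurable_prodMk_left) hYm]
        exact lintegral_prod_eq_prod_lintegral_of_indepFun _ (fun i ω => F i s (Y i ω))
          (hYi.comp (fun i t => F i s t) fun i => (hF i).comp measurable_prodMk_left)
          (fun i => (hF' i).comp measurable_prodMk_left)
    _ = _ := by
        rw [lintegral_map (Finset.measurable_fun_prod _ fun i _ =>
          (hF' i).lintegral_prod_right') hU]

end

/-! ### Laplace and generating functionals of Poisson processes. -/

section

variable {Ω : Type*}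

/-- The counting measure of the selected points. -/
noncomputable def pointMeasure (b : ℕ → Ω → Plane) (sel : ℕ → Ω → Bool) (ω : Ω) : Measure Plane :=
  Measure.sum fun i => if sel i ω = true then Measure.dirac (b i ω) else 0

lemma lintegral_pointMeasure (b : ℕ → Ω → Plane) (sel : ℕ → Ω → Bool) (ω : Ω) {f : Plane → ℝ≥0∞}
    (hf : Measurable f) :
    ∫⁻ x, f x ∂(pointMeasure b sel ω) = ∑' i, if sel i ω = true then f (b i ω) else 0 := by
  rw [pointMeasure, lintegral_sum_measure]
  refine tsum_congr fun i => ?_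
  split_ifs
  · exact lintegral_dirac' _ hf
  · simp

lemma pointMeasure_apply (b : ℕ → Ω → Plane) (sel : ℕ → Ω → Bool) (ω : Ω) {B : Set Plane}
    (hB : MeasurableSet B) :
    pointMeasure b sel ω B = (pointCount b sel B ω : ℝ≥0∞) := by
  rw [← lintegral_indicator_one hB, lintegral_pointMeasure b sel ω (measurable_one.indicator hB),
    pointCount, ← ENNReal.tsum_set_one, tsum_subtype _ (fun _ : ℕ => (1 : ℝ≥0∞))]
  refine tsum_congr fun i => ?_
  by_cases h1 : sel i ω = true <;> by_cases h2 : b i ω ∈ B <;> simp [h1, h2]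

variable [MeasurableSpace Ω] {b : ℕ → Ω → Plane} {sel : ℕ → Ω → Bool}

lemma measurable_pointCount (hb : ∀ i, Measurable (b i)) (hs : ∀ i, Measurable (sel i))
    {B : Set Plane} (hB : MeasurableSet B) : Measurable (pointCount b sel B) := by
  refine measurable_encard.comp (measurable_set_iff.2 fun i => ?_)
  exact measurableSet_setOfPred.1 ((hs i (measurableSet_singleton true)).inter (hb i hB))

variable {μ : Measure Ω} {dens : ℝ}

/-- The generating function of the Poisson law, from the exponential series; `z = 1` gives the total
mass. -/
lemma tsum_pow_mul_poissonMeasure (r : NNReal) {z : ℝ≥0∞} (hz : z ≤ 1) :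
    ∑' k : ℕ, z ^ k * poissonMeasure r {k} = nexp (r * (1 - z)) := by
  lift z to NNReal using (hz.trans_lt ENNReal.one_lt_top).ne
  have hz' : (z : ℝ) ≤ 1 := by exact_mod_cast hz
  have h1 : ∀ k : ℕ, (z : ℝ≥0∞) ^ k * poissonMeasure r {k} =
      ENNReal.ofReal (Real.exp (-r) * ((r * z : ℝ) ^ k / k.factorial)) := by
    intro k
    rw [poissonMeasure_singleton, ← ENNReal.ofReal_coe_nnreal (p := z),
      ← ENNReal.ofReal_pow z.coe_nonneg, ← ENNReal.ofReal_mul (by positivity)]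
    congr 1
    rw [mul_pow]
    ring
  have h2 : HasSum (fun k : ℕ => Real.exp (-r) * ((r * z : ℝ) ^ k / k.factorial))
      (Real.exp (-r) * Real.exp (r * z)) := by
    rw [Real.exp_eq_exp_ℝ]
    exact (NormedSpace.expSeries_div_hasSum_exp (r * z : ℝ)).mul_left _
  rw [tsum_congr h1, ← ENNReal.ofReal_tsum_of_nonneg (fun k => by positivity) h2.summable,
    h2.tsum_eq, ← Real.exp_add]
  have h3 : (r : ℝ≥0∞) * (1 - z) = ENNReal.ofReal (r * (1 - z)) := by
    rw [ENNReal.ofReal_mul r.coe_nonneg, ENNReal.ofReal_sub _ z.coe_nonneg]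
    simp
  rw [h3, nexp_ofReal (mul_nonneg r.coe_nonneg (by linarith))]
  congr 2
  ring

variable [IsProbabilityMeasure μ]

namespace IsHPPP

/-- Counts take values in `ℕ∞`, but the Poisson weights of the finite values already sum to `1`. -/
lemma measure_compl_iUnion_pointCount_eq (H : IsHPPP μ b sel dens) (hb : ∀ i, Measurable (b i))
    (hs : ∀ i, Measurable (sel i)) {B : Set Plane} (hB : MeasurableSet B) (hvB : volume B ≠ ∞) :
    μ (⋃ k : ℕ, {ω | pointCount b sel B ω = k})ᶜ = 0 := by
  have hm : ∀ k : ℕ, MeasurableSet {ω | pointCount b sel B ω = k} := fun k =>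
    measurable_pointCount hb hs hB (measurableSet_singleton _)
  rw [prob_compl_eq_zero_iff (MeasurableSet.iUnion hm), measure_iUnion ?_ hm]
  · simp only [H.poisson B hB hvB]
    have := tsum_pow_mul_poissonMeasure (dens * (volume B).toReal).toNNReal (le_refl 1)
    simpa [nexp_zero] using this
  · intro i j hij
    refine Set.disjoint_left.2 fun ω h1 h2 => hij ?_
    have : (i : ℕ∞) = j := h1.symm.trans h2
    exact_mod_cast this

lemma lintegral_nexp_mul_pointCount (H : IsHPPP μ b sel dens) (hb : ∀ i, Measurable (b i))
    (hs : ∀ i, Measurable (sel i)) {B : Set Plane} (hB : MeasurableSet B) (hvB : volume B ≠ ∞)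
    (c : ℝ≥0∞) :
    ∫⁻ ω, nexp (c * (pointCount b sel B ω : ℝ≥0∞)) ∂μ =
      nexp (ENNReal.ofReal dens * ((1 - nexp c) * volume B)) := by
  have hm : ∀ k : ℕ, MeasurableSet {ω | pointCount b sel B ω = k} := fun k =>
    measurable_pointCount hb hs hB (measurableSet_singleton _)
  have hae : (⋃ k : ℕ, {ω | pointCount b sel B ω = k}) =ᵐ[μ] Set.univ :=
    eventuallyEq_univ.2 (mem_ae_iff.2 (H.measure_compl_iUnion_pointCount_eq hb hs hB hvB))
  rw [← setLIntegral_univ, ← setLIntegral_congr hae, lintegral_iUnion hm ?_]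
  · have h1 : ∀ k : ℕ, ∫⁻ ω in {ω | pointCount b sel B ω = k},
        nexp (c * (pointCount b sel B ω : ℝ≥0∞)) ∂μ =
        nexp c ^ k * poissonMeasure (dens * (volume B).toReal).toNNReal {k} := by
      intro k
      rw [setLIntegral_congr_fun (g := fun _ => nexp c ^ k) (hm k) ?_]
      · rw [setLIntegral_const, H.poisson B hB hvB]
      · intro ω hω
        have hω' : pointCount b sel B ω = k := hω
        simp only [hω', ENat.toENNReal_coe]
        rw [mul_comm, nexp_natCast_mul]
    rw [tsum_congr h1, tsum_pow_mul_poissonMeasure _ (nexp_le_one c)]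
    congr 1
    have : (((dens * (volume B).toReal).toNNReal : NNReal) : ℝ≥0∞) =
        ENNReal.ofReal dens * volume B := by
      change ENNReal.ofReal (dens * (volume B).toReal) = _
      rw [ENNReal.ofReal_mul' ENNReal.toReal_nonneg, ENNReal.ofReal_toReal hvB]
    rw [this]
    ring
  · intro i j hij
    refine Set.disjoint_left.2 fun ω h1 h2 => hij ?_
    have : (i : ℕ∞) = j := h1.symm.trans h2
    exact_mod_cast this

/-- The level sets are disjoint, so their counts are independent and the expectation factorises over
the values of `f`. -/
lemma lintegral_nexp_simpleFunc (H : IsHPPP μ b sel dens) (hb : ∀ i, Measurable (b i))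
    (hs : ∀ i, Measurable (sel i)) (f : SimpleFunc Plane ℝ≥0∞)
    (hf : ∀ c ≠ 0, volume (f ⁻¹' {c}) ≠ ∞) :
    ∫⁻ ω, nexp (∫⁻ x, f x ∂(pointMeasure b sel ω)) ∂μ =
      nexp (ENNReal.ofReal dens * ∫⁻ x, (1 - nexp (f x))) := by
  have h1 : ∀ ω, nexp (∫⁻ x, f x ∂(pointMeasure b sel ω)) =
      ∏ c ∈ f.range, nexp (c * (pointCount b sel (f ⁻¹' {c}) ω : ℝ≥0∞)) := by
    intro ω
    rw [SimpleFunc.lintegral_eq_lintegral, SimpleFunc.lintegral, nexp_sum]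
    refine Finset.prod_congr rfl fun c _ => ?_
    rw [pointMeasure_apply _ _ _ (f.measurableSet_fiber c)]
  have h2 : ∫⁻ x, (1 - nexp (f x)) = ∑ c ∈ f.range, (1 - nexp c) * volume (f ⁻¹' {c}) := by
    rw [← SimpleFunc.map_lintegral (fun c => 1 - nexp c) f, ← SimpleFunc.lintegral_eq_lintegral]
    rfl
  rw [lintegral_congr h1, h2, Finset.mul_sum, nexp_sum]
  -- `IsHPPP.indep` is indexed by `Fin n`, so the values of `f` are enumerated.
  have hind : iIndepFun (fun c : f.range => pointCount b sel (f ⁻¹' {(c : ℝ≥0∞)})) μ := by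
    have := H.indep f.range.card (fun j => f ⁻¹' {((f.range.equivFin.symm j : f.range) : ℝ≥0∞)})
      (fun j => f.measurableSet_fiber _) fun i j hij => by
        refine Set.disjoint_left.2 fun x h1 h2 => hij ?_
        have h3 : ((f.range.equivFin.symm i : f.range) : ℝ≥0∞) = (f.range.equivFin.symm j : f.range) :=
          (Set.mem_singleton_iff.1 h1).symm.trans h2
        exact f.range.equivFin.symm.injective (Subtype.ext h3)
    have h4 := this.precomp (g := f.range.equivFin) f.range.equivFin.injective
    simpa using h4
  have hm : ∀ c : f.range, Measurable fun n : ℕ∞ => nexp ((c : ℝ≥0∞) * (n : ℝ≥0∞)) := fun c =>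
    measurable_from_top
  have h5 := lintegral_prod_eq_prod_lintegral_of_indepFun Finset.univ
    (fun (c : f.range) ω => nexp ((c : ℝ≥0∞) * (pointCount b sel (f ⁻¹' {(c : ℝ≥0∞)}) ω : ℝ≥0∞)))
    (hind.comp (fun c n => nexp ((c : ℝ≥0∞) * (n : ℝ≥0∞))) hm)
    (fun c => (hm c).comp (measurable_pointCount hb hs (f.measurableSet_fiber _)))
  have h6 : ∀ ω, ∏ c ∈ f.range, nexp (c * (pointCount b sel (f ⁻¹' {c}) ω : ℝ≥0∞)) =
      ∏ c : f.range, nexp ((c : ℝ≥0∞) * (pointCount b sel (f ⁻¹' {(c : ℝ≥0∞)}) ω : ℝ≥0∞)) :=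
    fun ω => (Finset.prod_coe_sort f.range fun c =>
      nexp (c * (pointCount b sel (f ⁻¹' {c}) ω : ℝ≥0∞))).symm
  rw [lintegral_congr h6, h5, Finset.prod_coe_sort f.range fun c =>
    ∫⁻ ω, nexp (c * (pointCount b sel (f ⁻¹' {c}) ω : ℝ≥0∞)) ∂μ]
  refine Finset.prod_congr rfl fun c _ => ?_
  -- The zero level set may have infinite area, but it contributes the factor `1` on both sides.
  rcases eq_or_ne c 0 with rfl | hc
  · simp [nexp_zero]
  · exact H.lintegral_nexp_mul_pointCount hb hs (f.measurableSet_fiber c) (hf c hc) c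

/-- The Laplace functional of a Poisson process. -/
theorem lintegral_nexp_lintegral (H : IsHPPP μ b sel dens) (hb : ∀ i, Measurable (b i))
    (hs : ∀ i, Measurable (sel i)) {f : Plane → ℝ≥0∞} (hf : Measurable f) :
    ∫⁻ ω, nexp (∫⁻ x, f x ∂(pointMeasure b sel ω)) ∂μ =
      nexp (ENNReal.ofReal dens * ∫⁻ x, (1 - nexp (f x))) := by
  -- Truncation to balls makes all nonzero level sets of finite area while keeping monotone
  -- convergence to `f`.
  let F : ℕ → SimpleFunc Plane ℝ≥0∞ := fun n =>
    (SimpleFunc.eapprox f n).restrict (Metric.ball 0 n)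
  have hFapply : ∀ n x, F n x = (Metric.ball (0 : Plane) n).indicator (SimpleFunc.eapprox f n) x :=
    fun n x => SimpleFunc.restrict_apply _ Metric.isOpen_ball.measurableSet x
  have hFmono : ∀ x, Monotone fun n => F n x := by
    intro x m n hmn
    simp only [hFapply]
    refine (Set.indicator_le_indicator_of_subset
      (Metric.ball_subset_ball (Nat.cast_le.2 hmn)) (fun _ => zero_le) x).trans ?_
    exact Set.indicator_le_indicator (SimpleFunc.monotone_eapprox f hmn x)
  have hFlim : ∀ x, Tendsto (fun n => F n x) atTop (𝓝 (f x)) := by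
    intro x
    have h1 : Tendsto (fun n => SimpleFunc.eapprox f n x) atTop (𝓝 (f x)) := by
      rw [← SimpleFunc.iSup_eapprox_apply hf x]
      exact tendsto_atTop_iSup fun m n hmn => SimpleFunc.monotone_eapprox f hmn x
    refine h1.congr' ?_
    obtain ⟨N, hN⟩ := exists_nat_gt ‖x‖
    filter_upwards [eventually_ge_atTop N] with n hn
    have : x ∈ Metric.ball (0 : Plane) n := by
      rw [mem_ball_zero_iff]
      exact hN.trans_le (by exact_mod_cast hn)
    rw [hFapply, Set.indicator_of_mem this]
  have hFfin : ∀ n, ∀ c ≠ 0, volume (F n ⁻¹' {c}) ≠ ∞ := by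
    intro n c hc
    refine ((measure_mono ?_).trans_lt (measure_ball_lt_top (μ := volume) (x := (0 : Plane))
      (r := n))).ne
    intro x hx
    by_contra hxb
    refine hc ?_
    rw [← Set.mem_singleton_iff.1 hx, hFapply, Set.indicator_of_notMem hxb]
  have hI : ∀ (ν : Measure Plane), Tendsto (fun n => ∫⁻ x, F n x ∂ν) atTop (𝓝 (∫⁻ x, f x ∂ν)) :=
    fun ν => lintegral_tendsto_of_tendsto_of_monotone (fun n => (F n).measurable.aemeasurable)
      (ae_of_all _ hFmono) (ae_of_all _ hFlim)
  have hmeas : ∀ n, Measurable fun ω => nexp (∫⁻ x, F n x ∂(pointMeasure b sel ω)) := by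
    intro n
    refine measurable_nexp.comp ?_
    simp only [lintegral_pointMeasure _ _ _ (F n).measurable]
    exact Measurable.tsum fun i =>
      Measurable.ite (hs i (measurableSet_singleton true)) ((F n).measurable.comp (hb i))
        measurable_const
  have hL : Tendsto (fun n => ∫⁻ ω, nexp (∫⁻ x, F n x ∂(pointMeasure b sel ω)) ∂μ) atTop
      (𝓝 (∫⁻ ω, nexp (∫⁻ x, f x ∂(pointMeasure b sel ω)) ∂μ)) :=
    tendsto_lintegral_of_dominated_convergence (fun _ => 1) hmeas
      (fun n => ae_of_all _ fun ω => nexp_le_one _) (by simp)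
      (ae_of_all _ fun ω => (continuous_nexp.tendsto _).comp (hI _))
  have hR : Tendsto (fun n => nexp (ENNReal.ofReal dens * ∫⁻ x, (1 - nexp (F n x)))) atTop
      (𝓝 (nexp (ENNReal.ofReal dens * ∫⁻ x, (1 - nexp (f x))))) := by
    refine (continuous_nexp.tendsto _).comp (ENNReal.Tendsto.const_mul ?_
      (Or.inr ENNReal.ofReal_ne_top))
    refine lintegral_tendsto_of_tendsto_of_monotone
      (fun n => (measurable_const.sub (measurable_nexp.comp (F n).measurable)).aemeasurable)
      (ae_of_all _ fun x m n h => tsub_le_tsub_left (nexp_antitone (hFmono x h)) 1)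
      (ae_of_all _ fun x => ?_)
    exact ENNReal.Tendsto.sub tendsto_const_nhds ((continuous_nexp.tendsto _).comp (hFlim x))
      (Or.inl ENNReal.one_ne_top)
  refine tendsto_nhds_unique hL (hR.congr fun n => ?_)
  exact (H.lintegral_nexp_simpleFunc hb hs (F n) (hFfin n)).symm

/-- The probability generating functional of a Poisson process. -/
theorem lintegral_infProd (H : IsHPPP μ b sel dens) (hb : ∀ i, Measurable (b i))
    (hs : ∀ i, Measurable (sel i)) {v : Plane → ℝ≥0∞} (hv : Measurable v) (hv1 : ∀ x, v x ≤ 1) :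
    ∫⁻ ω, infProd (fun i => if sel i ω = true then v (b i ω) else 1) ∂μ =
      nexp (ENNReal.ofReal dens * ∫⁻ x, (1 - v x)) := by
  -- The Laplace functional at `f = nlog ∘ v`; a zero of `v` corresponds to the value `∞` of `f`.
  have h := H.lintegral_nexp_lintegral hb hs (measurable_nlog.comp hv)
  simp only [Function.comp_apply, nexp_nlog (hv1 _)] at h
  rw [← h]
  refine lintegral_congr fun ω => ?_
  rw [lintegral_pointMeasure _ _ _ (f := fun x => nlog (v x)) (measurable_nlog.comp hv), nexp_tsum]
  congr 1
  ext i
  split_ifs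
  · rw [nexp_nlog (hv1 _)]
  · rw [nexp_zero]

end IsHPPP

end

/-! ### Polar coordinates and the exponential law. -/

lemma lintegral_plane_norm {f : ℝ → ℝ≥0∞} (hf : Measurable f) :
    ∫⁻ x : Plane, f ‖x‖ = ENNReal.ofReal (2 * Real.pi) *
      ∫⁻ u in Set.Ioi (0 : ℝ), ENNReal.ofReal u * f u := by
  have hdim : Module.finrank ℝ Plane = 2 := by simp [Plane]
  have hmp := (volume : Measure Plane).measurePreserving_homeomorphUnitSphereProd
  rw [hdim] at hmp
  have hsph : (volume : Measure Plane).toSphere Set.univ = ENNReal.ofReal (2 * Real.pi) := by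
    rw [Measure.toSphere_apply_univ, hdim, EuclideanSpace.volume_ball_fin_two,
      ENNReal.ofReal_mul (by norm_num)]
    simp
  calc ∫⁻ x : Plane, f ‖x‖
      = ∫⁻ x : ({(0)}ᶜ : Set Plane), f ‖x.1‖ ∂(Measure.comap Subtype.val volume) := by
        rw [lintegral_subtype_comap (measurableSet_singleton _).compl (fun x : Plane => f ‖x‖),
          restrict_compl_singleton]
    _ = ∫⁻ x, f x.2 ∂((volume : Measure Plane).toSphere.prod (Measure.volumeIoiPow (2 - 1))) := by
        rw [← hmp.lintegral_comp_emb (Homeomorph.measurableEmbedding _)]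
        simp
    _ = (∫⁻ x : Set.Ioi (0 : ℝ), f x ∂(Measure.volumeIoiPow (2 - 1))) *
          (volume : Measure Plane).toSphere Set.univ := by
        rw [lintegral_prod (fun x : Metric.sphere (0 : Plane) 1 × Set.Ioi (0 : ℝ) => f x.2)
          (hf.comp (measurable_subtype_coe.comp measurable_snd)).aemeasurable]
        simp only [lintegral_const]
    _ = _ := by
        rw [hsph, mul_comm, Measure.volumeIoiPow, lintegral_withDensity_eq_lintegral_mul _
          ((measurable_subtype_coe.pow_const _).ennreal_ofReal)
          (g := fun x : Set.Ioi (0 : ℝ) => f x) (hf.comp measurable_subtype_coe)]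
        congr 1
        rw [← lintegral_subtype_comap measurableSet_Ioi fun u : ℝ => ENNReal.ofReal u * f u]
        simp

section Exponential

lemma expMeasure_absolutelyContinuous (r : ℝ) : expMeasure r ≪ volume :=
  withDensity_absolutelyContinuous _ _

/-- Tilting the mean-one exponential density by `exp (-a x)` gives `1 / (1 + a)` times the density
of rate `1 + a`. -/
lemma lintegral_expMeasure_nexp {a : ℝ} (ha : 0 ≤ a) :
    ∫⁻ x, nexp (ENNReal.ofReal (a * x)) ∂(expMeasure 1) = ENNReal.ofReal (1 / (1 + a)) := by
  have h : expMeasure 1 = volume.withDensity (exponentialPDF 1) := rfl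
  have hm : ∀ r, Measurable (exponentialPDF r) := fun r =>
    (measurable_exponentialPDFReal r).ennreal_ofReal
  rw [h, lintegral_withDensity_eq_lintegral_mul _ (hm 1)
    (g := fun x => nexp (ENNReal.ofReal (a * x))) (measurable_nexp.comp (by fun_prop))]
  have h1 : ∀ x, (exponentialPDF 1 * fun x => nexp (ENNReal.ofReal (a * x))) x =
      ENNReal.ofReal (1 / (1 + a)) * exponentialPDF (1 + a) x := by
    intro x
    simp only [Pi.mul_apply, exponentialPDF_eq]
    split_ifs with hx
    · rw [nexp_ofReal (by positivity), ← ENNReal.ofReal_mul (by positivity),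
        ← ENNReal.ofReal_mul (by positivity)]
      congr 1
      rw [one_mul, ← Real.exp_add]
      field_simp
      congr 1
      ring
    · simp
  rw [lintegral_congr h1, lintegral_const_mul _ (hm _),
    lintegral_exponentialPDF_eq_one (by positivity), mul_one]

lemma expMeasure_Ioi {t : ℝ} (ht : 0 ≤ t) :
    expMeasure 1 (Set.Ioi t) = ENNReal.ofReal (Real.exp (-t)) := by
  have := isProbabilityMeasure_expMeasure (r := 1) one_pos
  have h1 := cdf_expMeasure_eq (r := 1) one_pos t
  rw [if_pos ht, one_mul, cdf_eq_real] at h1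
  have h2 : (expMeasure 1).real (Set.Ioi t) = Real.exp (-t) := by
    rw [← Set.compl_Iic, probReal_compl_eq_one_sub measurableSet_Iic, h1]
    ring
  rw [← h2, ofReal_measureReal]

lemma expMeasure_lt_ofReal (K : ℝ≥0∞) : expMeasure 1 {x | K < ENNReal.ofReal x} = nexp K := by
  rcases eq_or_ne K ∞ with rfl | hK
  · simp [nexp_top]
  · have : {x | K < ENNReal.ofReal x} = Set.Ioi K.toReal := by
      ext x
      simp [ENNReal.lt_ofReal_iff_toReal_lt hK]
    rw [this, expMeasure_Ioi ENNReal.toReal_nonneg, nexp_eq_ofReal hK]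

end Exponential

/-! ### Path loss near the origin and at infinity, and the density of active BSs. -/

namespace RadioModel

variable {M : RadioModel}

lemma continuous_dist3 (M : RadioModel) : Continuous M.dist3 := by
  unfold dist3
  fun_prop

lemma dist3_zero (hL : 0 < M.L) : M.dist3 0 = M.L := by
  simp [dist3, Real.sqrt_sq hL.le]

lemma le_dist3 (M : RadioModel) (r : ℝ) : M.L ≤ M.dist3 r :=
  Real.le_sqrt_of_sq_le (by nlinarith [sq_nonneg r])

lemma lt_dist3 (M : RadioModel) {r : ℝ} (hr : r ≠ 0) : M.L < M.dist3 r :=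
  Real.lt_sqrt_of_sq_lt (by have := sq_pos_of_ne_zero hr; linarith)

lemma le_dist3_self (M : RadioModel) (r : ℝ) : r ≤ M.dist3 r :=
  Real.le_sqrt_of_sq_le (by nlinarith [sq_nonneg M.L])

lemma piece_mono (M : RadioModel) : Monotone M.piece := fun a b hab => by
  refine Fin.mk_le_mk.2 (Finset.card_le_card ?_)
  intro i hi
  simp only [Finset.mem_filter, Finset.mem_univ, true_and] at hi ⊢
  exact hi.trans_le hab

lemma measurable_piece (M : RadioModel) : Measurable M.piece := by
  refine measurable_to_countable' fun n => ?_
  exact (Set.ordConnected_singleton.preimage_mono M.piece_mono).measurableSet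

lemma measurable_piecewise (M : RadioModel) {f : Fin (M.m + 1) → ℝ → ℝ} (hf : ∀ n, Measurable (f n)) :
    Measurable fun w => f (M.piece w) w :=
  (measurable_from_prod_countable_right (f := fun p : Fin (M.m + 1) × ℝ => f p.1 p.2) hf).comp
    (M.measurable_piece.prodMk measurable_id)

lemma measurable_gainL (M : RadioModel) : Measurable M.gainL :=
  M.measurable_piecewise (f := fun n w => M.AL n * w ^ (-M.αL n)) fun _ => by fun_prop

lemma measurable_gainNL (M : RadioModel) : Measurable M.gainNL :=
  M.measurable_piecewise (f := fun n w => M.ANL n * w ^ (-M.αNL n)) fun _ => by fun_prop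

namespace Admissible

/-- `PrL n` is arbitrary off its piece, so `prLoS` itself need not be measurable. On each piece it
is monotone and bounded, hence extends to an antitone function on the line. -/
lemma exists_measurable_prLoS (hM : M.Admissible) :
    ∃ p : ℝ → ℝ, Measurable p ∧ ∀ w, M.L ≤ w → M.prLoS w = p w := by
  have h : ∀ n, ∃ g : ℝ → ℝ, Antitone g ∧
      Set.EqOn (M.PrL n) g {w | M.L ≤ w ∧ M.piece w = n} := by
    intro n
    refine (hM.PrL_anti n).exists_antitone_extension ⟨0, ?_⟩ ⟨1, ?_⟩
    · rintro _ ⟨w, ⟨hw, rfl⟩, rfl⟩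
      exact (hM.prLoS_mem w hw).1
    · rintro _ ⟨w, ⟨hw, rfl⟩, rfl⟩
      exact (hM.prLoS_mem w hw).2
  choose g hg hgeq using h
  exact ⟨fun w => g (M.piece w) w, M.measurable_piecewise fun n => (hg n).measurable,
    fun w hw => hgeq _ ⟨hw, rfl⟩⟩

lemma gainL_pos (hM : M.Admissible) {w : ℝ} (hw : 0 < w) : 0 < M.gainL w :=
  mul_pos (hM.AL_pos _) (Real.rpow_pos_of_pos hw _)

lemma gainNL_pos (hM : M.Admissible) {w : ℝ} (hw : 0 < w) : 0 < M.gainNL w :=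
  mul_pos (hM.ANL_pos _) (Real.rpow_pos_of_pos hw _)

lemma peakGain_pos (hM : M.Admissible) (hL : 0 < M.L) : 0 < M.peakGain :=
  mul_pos (hM.AL_pos _) (Real.rpow_pos_of_pos hL _)

end Admissible

/-- Pieces are open on the left, apart from the end point `L` excluded here. This room makes the
bound by `peakGain` strict beyond distance `L`. -/
lemma exists_lt_piece_eq (M : RadioModel) {w : ℝ} (hw : M.L < w) :
    ∃ w', M.L < w' ∧ w' < w ∧ M.piece w' = M.piece w := by
  have h1 : ∀ᶠ w' in 𝓝[<] w, ∀ i, M.d i < w → M.d i < w' := by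
    refine eventually_all.2 fun i => ?_
    by_cases hi : M.d i < w
    · filter_upwards [Ioo_mem_nhdsLT hi] with w' hw' _ using hw'.1
    · exact Eventually.of_forall fun w' h => absurd h hi
  obtain ⟨w', hw', hw'2⟩ := (h1.and (Ioo_mem_nhdsLT hw)).exists
  refine ⟨w', hw'2.1, hw'2.2, le_antisymm (M.piece_mono hw'2.2.le) ?_⟩
  refine Fin.mk_le_mk.2 (Finset.card_le_card ?_)
  intro i hi
  simp only [Finset.mem_filter, Finset.mem_univ, true_and] at hi ⊢
  exact hw' i hi

namespace Admissible

/-- A slightly shorter link in the same piece is strictly stronger, yet still bounded by `peakGain`.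
-/
lemma gainL_lt (hM : M.Admissible) (hL : 0 < M.L) {w : ℝ} (hw : M.L < w) :
    M.gainL w < M.peakGain := by
  obtain ⟨w', h1, h2, h3⟩ := M.exists_lt_piece_eq hw
  refine lt_of_lt_of_le ?_ (hM.gainL_le w' h1.le)
  rw [gainL, gainL, h3]
  exact mul_lt_mul_of_pos_left (Real.rpow_lt_rpow_of_neg (hL.trans h1) h2
    (neg_neg_of_pos (hM.αL_pos _))) (hM.AL_pos _)

lemma gainNL_lt (hM : M.Admissible) (hL : 0 < M.L) {w : ℝ} (hw : M.L < w) :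
    M.gainNL w < M.peakGain := by
  obtain ⟨w', h1, h2, h3⟩ := M.exists_lt_piece_eq hw
  refine lt_of_lt_of_le ?_ (hM.gainNL_le w' h1.le)
  rw [gainNL, gainNL, h3]
  exact mul_lt_mul_of_pos_left (Real.rpow_lt_rpow_of_neg (hL.trans h1) h2
    (neg_neg_of_pos (hM.αNL_pos _))) (hM.ANL_pos _)

/-- Each gain is dominated by the sum of the finitely many power laws, all of which decay. -/
lemma tendsto_gain_atTop (hM : M.Admissible) :
    Tendsto (fun w => max (M.gainL w) (M.gainNL w)) atTop (𝓝 0) := by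
  have h : ∀ (A α : Fin (M.m + 1) → ℝ), (∀ n, 0 < A n) → (∀ n, 0 < α n) →
      Tendsto (fun w => A (M.piece w) * w ^ (-α (M.piece w))) atTop (𝓝 0) := by
    intro A α hA hα
    have h1 : Tendsto (fun w : ℝ => ∑ n, A n * w ^ (-α n)) atTop (𝓝 0) := by
      rw [show (0 : ℝ) = ∑ n : Fin (M.m + 1), A n * 0 by simp]
      exact tendsto_finsetSum _ fun n _ =>
        (tendsto_rpow_neg_atTop (hα n)).const_mul _
    refine squeeze_zero' ?_ ?_ h1
    · filter_upwards [eventually_ge_atTop 0] with w hw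
      exact mul_nonneg (hA _).le (Real.rpow_nonneg hw _)
    · filter_upwards [eventually_ge_atTop 0] with w hw
      exact Finset.single_le_sum (f := fun n => A n * w ^ (-α n))
        (fun n _ => mul_nonneg (hA _).le (Real.rpow_nonneg hw _)) (Finset.mem_univ _)
  simpa [gainL, gainNL] using (h M.AL M.αL hM.AL_pos hM.αL_pos).max (h M.ANL M.αNL hM.ANL_pos hM.αNL_pos)

end Admissible

/-- The positions from which a link can have a gain of at least `t`. -/
def strongSet (M : RadioModel) (t : ℝ) : Set Plane :=
  {x | t ≤ max (M.gainL (M.dist3 ‖x‖)) (M.gainNL (M.dist3 ‖x‖))}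

lemma measurableSet_strongSet (M : RadioModel) (t : ℝ) : MeasurableSet (M.strongSet t) := by
  have h : Measurable fun x : Plane => M.dist3 ‖x‖ :=
    M.continuous_dist3.measurable.comp measurable_norm
  exact measurableSet_le measurable_const
    ((M.measurable_gainL.comp h).max (M.measurable_gainNL.comp h))

namespace Admissible

lemma volume_strongSet_ne_top (hM : M.Admissible) {t : ℝ} (ht : 0 < t) :
    volume (M.strongSet t) ≠ ∞ := by
  obtain ⟨R, hR⟩ := eventually_atTop.1 (hM.tendsto_gain_atTop.eventually_lt_const ht)
  refine ((measure_mono ?_).trans_lt (measure_ball_lt_top (μ := volume) (x := (0 : Plane))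
    (r := R))).ne
  intro x hx
  rw [mem_ball_zero_iff]
  by_contra hxR
  exact absurd hx (not_le.2 (hR _ ((not_lt.1 hxR).trans (M.le_dist3_self _))))

/-- Only the origin can attain `peakGain`, so the sets decrease to a null set. Decay of the gains at
infinity gives the finite area needed for continuity from above. -/
lemma tendsto_volume_strongSet (hM : M.Admissible) (hL : 0 < M.L) {t : ℕ → ℝ} (ht : Monotone t)
    (ht0 : ∀ n, 0 < t n) (htl : Tendsto t atTop (𝓝 M.peakGain)) :
    Tendsto (fun n => volume (M.strongSet (t n))) atTop (𝓝 0) := by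
  have h := tendsto_measure_iInter_atTop (μ := (volume : Measure Plane))
    (s := fun n => M.strongSet (t n)) (fun n => (M.measurableSet_strongSet _).nullMeasurableSet)
    (fun m n hmn x hx => (ht hmn).trans hx) ⟨0, hM.volume_strongSet_ne_top (ht0 0)⟩
  have h0 : volume (⋂ n, M.strongSet (t n)) = 0 := by
    refine measure_mono_null (t := {0}) ?_ (by simp)
    intro x hx
    by_contra hx0
    have hd := M.lt_dist3 (norm_ne_zero_iff.2 hx0)
    have h1 : M.peakGain ≤ max (M.gainL (M.dist3 ‖x‖)) (M.gainNL (M.dist3 ‖x‖)) :=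
      le_of_tendsto' htl fun n => Set.mem_iInter.1 hx n
    exact absurd h1 (not_le.2 (max_lt (hM.gainL_lt hL hd) (hM.gainNL_lt hL hd)))
  rwa [h0] at h

/-- The witness in `PrL_pos` bounds the LoS probability below at all shorter distances by
monotonicity; the gain bound is continuity at distance `L`. -/
lemma exists_near (hM : M.Admissible) (hL : 0 < M.L) {t : ℝ} (ht : t < M.peakGain) :
    ∃ r > 0, ∃ p > 0, ∀ x : ℝ, |x| < r → p ≤ M.prLoS (M.dist3 x) ∧ t ≤ M.gainL (M.dist3 x) := by
  obtain ⟨w, hw, hw0, hwp⟩ := hM.PrL_pos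
  have hpiece : ∀ v, v ≤ w → M.piece v = 0 := fun v hv =>
    le_antisymm ((M.piece_mono hv).trans hw0.le) (Fin.zero_le _)
  have h1 : Tendsto (fun x => M.dist3 x) (𝓝 0) (𝓝 M.L) := by
    simpa [dist3_zero hL] using M.continuous_dist3.tendsto 0
  have h2 : Tendsto (fun x => M.AL 0 * M.dist3 x ^ (-M.αL 0)) (𝓝 0) (𝓝 M.peakGain) :=
    (h1.rpow_const (Or.inl hL.ne')).const_mul _
  obtain ⟨r, hr, h3⟩ := Metric.eventually_nhds_iff.1
    ((h1.eventually_lt_const hw).and (h2.eventually_const_le ht))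
  refine ⟨r, hr, M.PrL 0 w, hwp, fun x hx => ?_⟩
  obtain ⟨h4, h5⟩ := h3 (y := x) (by simpa [Real.dist_eq] using hx)
  have h6 := hpiece _ h4.le
  rw [prLoS, gainL, h6]
  exact ⟨hM.PrL_anti 0 ⟨M.le_dist3 x, h6⟩ ⟨hw.le, hw0⟩ h4.le, h5⟩

/-- With `t = 1 / l`, the active density is the difference quotient at `0` of `-(1 + ρ t / q) ^
(-q)`, whose derivative there is `ρ`. -/
lemma tendsto_activeDensity (hM : M.Admissible) (ρ : ℝ) :
    Tendsto (fun l => M.activeDensity ρ l) atTop (𝓝 ρ) := by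
  have hq := hM.q_pos
  have hd : HasDerivAt (fun t : ℝ => -(1 + ρ / M.q * t) ^ (-M.q)) ρ 0 := by
    have h1 : HasDerivAt (fun t : ℝ => 1 + ρ / M.q * t) (ρ / M.q) 0 := by
      simpa using ((hasDerivAt_id (0 : ℝ)).const_mul (ρ / M.q)).const_add 1
    have h2 := (h1.rpow_const (p := -M.q) (Or.inl (by simp))).fun_neg
    refine h2.congr_deriv ?_
    simp
    field_simp
  have h3 := hd.tendsto_slope_zero_right.comp tendsto_inv_atTop_nhdsGT_zero
  have h0 : Tendsto (fun l : ℝ => 1 + ρ / M.q * l⁻¹) atTop (𝓝 1) := by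
    simpa using (tendsto_inv_atTop_zero.const_mul (ρ / M.q)).const_add 1
  refine h3.congr' ?_
  filter_upwards [h0.eventually_const_lt one_pos, eventually_gt_atTop 0] with l hl hl0
  simp only [Function.comp_apply, inv_inv, zero_add, smul_eq_mul, mul_zero, add_zero,
    Real.one_rpow, activeDensity]
  rw [Real.rpow_neg hl.le, one_div]
  have : ρ / M.q * l⁻¹ = ρ / (M.q * l) := by field_simp
  rw [this]
  ring

end Admissible

end RadioModel

/-! ### Regrouping independence and the gain of a single link. -/

lemma indepFun_prodMk_left {Ω A B C : Type*} [MeasurableSpace Ω] [MeasurableSpace A]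
    [MeasurableSpace B] [MeasurableSpace C] {μ : Measure Ω} [IsProbabilityMeasure μ]
    {U : Ω → A} {V : Ω → B} {W : Ω → C} (hU : Measurable U) (hV : Measurable V)
    (hW : Measurable W) (h1 : IndepFun U (fun ω => (V ω, W ω)) μ) (h2 : IndepFun V W μ) :
    IndepFun (fun ω => (U ω, V ω)) W μ := by
  have hUV : IndepFun U V μ := h1.comp (φ := id) (ψ := Prod.fst) measurable_id measurable_fst
  have := Measure.isProbabilityMeasure_map (μ := μ) hU.aemeasurable
  have := Measure.isProbabilityMeasure_map (μ := μ) hV.aemeasurable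
  have := Measure.isProbabilityMeasure_map (μ := μ) hW.aemeasurable
  rw [indepFun_iff_map_prod_eq_prod_map_map (hU.prodMk hV).aemeasurable hW.aemeasurable,
    hUV.map_prod_eq_prod_map_map hU.aemeasurable hV.aemeasurable]
  have h3 := h1.map_prod_eq_prod_map_map hU.aemeasurable (hV.prodMk hW).aemeasurable
  rw [h2.map_prod_eq_prod_map_map hV.aemeasurable hW.aemeasurable] at h3
  have h4 := (measurePreserving_prodAssoc (μ.map U) (μ.map V) (μ.map W)).symm
  rw [← h4.map_eq, ← h3, Measure.map_map h4.measurable (hU.prodMk (hV.prodMk hW))]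
  rfl

namespace RadioModel

variable {M : RadioModel}

/-- The gain of a link from position `x` whose line-of-sight mark is `t`. -/
noncomputable def linkGain (M : RadioModel) (x : Plane) (t : ℝ) : ℝ :=
  if t ≤ M.prLoS (M.dist3 ‖x‖) then M.gainL (M.dist3 ‖x‖) else M.gainNL (M.dist3 ‖x‖)

namespace Admissible

lemma measurable_linkGain (hM : M.Admissible) : Measurable (Function.uncurry M.linkGain) := by
  obtain ⟨p, hp, hpeq⟩ := hM.exists_measurable_prLoS
  have hd : Measurable fun y : Plane × ℝ => M.dist3 ‖y.1‖ :=
    M.continuous_dist3.measurable.comp (measurable_norm.comp measurable_fst)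
  have h : Function.uncurry M.linkGain = fun y : Plane × ℝ =>
      if y.2 ≤ p (M.dist3 ‖y.1‖) then M.gainL (M.dist3 ‖y.1‖) else M.gainNL (M.dist3 ‖y.1‖) := by
    ext ⟨x, t⟩
    simp only [Function.uncurry, linkGain, hpeq _ (M.le_dist3 ‖x‖)]
  rw [h]
  exact Measurable.ite (measurableSet_le measurable_snd (hp.comp hd))
    (M.measurable_gainL.comp hd) (M.measurable_gainNL.comp hd)

lemma linkGain_pos (hM : M.Admissible) (hL : 0 < M.L) (x : Plane) (t : ℝ) : 0 < M.linkGain x t := by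
  have h := hL.trans_le (M.le_dist3 ‖x‖)
  unfold linkGain
  split_ifs
  exacts [hM.gainL_pos h, hM.gainNL_pos h]

lemma linkGain_le (hM : M.Admissible) (x : Plane) (t : ℝ) : M.linkGain x t ≤ M.peakGain := by
  unfold linkGain
  split_ifs
  exacts [hM.gainL_le _ (M.le_dist3 _), hM.gainNL_le _ (M.le_dist3 _)]

lemma measurable_linkGain_comp (hM : M.Admissible) {S : Type*} [MeasurableSpace S] {f : S → Plane}
    {g : S → ℝ} (hf : Measurable f) (hg : Measurable g) :
    Measurable fun s => M.linkGain (f s) (g s) :=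
  hM.measurable_linkGain.comp (hf.prodMk hg)

end Admissible

end RadioModel

/-! ### The load, measurability, and integration over the serving fading. -/

namespace Network

lemma gain_eq {Ω : Type*} (X : Network Ω) (M : RadioModel) (i : ℕ) (ω : Ω) :
    X.gain M i ω = M.linkGain (X.pos i ω) (X.mark i ω) := rfl

/-- The sum of interference and noise, divided by the mean power of the serving link. -/
noncomputable def load {Ω : Type*} (X : Network Ω) (M : RadioModel) (ω : Ω) : ℝ≥0∞ :=
  (X.interference M ω + ENNReal.ofReal M.PN) / ENNReal.ofReal (M.P * X.gain M (X.serving M ω) ω)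

section

variable {Ω : Type*} {X : Network Ω} {M : RadioModel}

lemma load_ne_zero (hM : M.Admissible) (ω : Ω) : X.load M ω ≠ 0 := by
  refine (ENNReal.div_pos ?_ ENNReal.ofReal_ne_top).ne'
  exact (lt_of_lt_of_le (ENNReal.ofReal_pos.2 hM.PN_pos) le_add_self).ne'

lemma sinr_eq (hM : M.Admissible) (hL : 0 < M.L) (ω : Ω) :
    X.sinr M ω = (ENNReal.ofReal (X.h ω) / X.load M ω).toReal := by
  have h : 0 < M.P * X.gain M (X.serving M ω) ω := mul_pos hM.P_pos (hM.linkGain_pos hL _ _)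
  rw [sinr, load, ENNReal.ofReal_mul h.le, ENNReal.div_eq_inv_mul, ENNReal.div_eq_inv_mul,
    ENNReal.inv_div (Or.inl ENNReal.ofReal_ne_top) (Or.inl (ENNReal.ofReal_pos.2 h).ne'),
    ENNReal.div_eq_inv_mul, mul_assoc]

/-- Coverage becomes a threshold event for `h`. If the load is infinite, both sides fail, in line
with the convention for a divergent interference. -/
lemma lt_sinr_iff (hM : M.Admissible) (hL : 0 < M.L) {γ : ℝ} (hγ : 0 < γ) (ω : Ω) :
    γ < X.sinr M ω ↔ ENNReal.ofReal γ * X.load M ω < ENNReal.ofReal (X.h ω) := by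
  have h0 := load_ne_zero (X := X) hM ω
  rw [sinr_eq hM hL]
  rcases eq_or_ne (X.load M ω) ∞ with h | h
  · rw [h, ENNReal.mul_top (ENNReal.ofReal_pos.2 hγ).ne']
    simp [hγ.le]
  · rw [← ENNReal.ofReal_lt_iff_lt_toReal hγ.le (ENNReal.div_ne_top ENNReal.ofReal_ne_top h0),
      ENNReal.lt_div_iff_mul_lt (Or.inl h0) (Or.inl h)]

lemma le_load (hM : M.Admissible) (hL : 0 < M.L) (ω : Ω) :
    ENNReal.ofReal (M.PN / (M.P * M.peakGain)) ≤ X.load M ω := by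
  have h : 0 < M.P * M.peakGain := mul_pos hM.P_pos (hM.peakGain_pos hL)
  rw [ENNReal.ofReal_div_of_pos h]
  exact ENNReal.div_le_div le_add_self (ENNReal.ofReal_le_ofReal
    (mul_le_mul_of_nonneg_left (hM.linkGain_le _ _) hM.P_pos.le))

end

variable {Ω : Type*} [MeasurableSpace Ω] {X : Network Ω} {M : RadioModel}

/-- The components of a network are measurable. -/
structure IsMeasurable (X : Network Ω) : Prop where
  pos : ∀ i, Measurable (X.pos i)
  active : ∀ i, Measurable (X.active i)
  mark : ∀ i, Measurable (X.mark i)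
  g : ∀ i, Measurable (X.g i)
  h : Measurable X.h

namespace IsMeasurable

lemma gain (hX : X.IsMeasurable) (hM : M.Admissible) (i : ℕ) : Measurable (X.gain M i) :=
  hM.measurable_linkGain_comp (hX.pos i) (hX.mark i)

lemma serving (hX : X.IsMeasurable) (hM : M.Admissible) : Measurable (X.serving M) := by
  have hp : ∀ i, MeasurableSet {ω | ∀ j, X.gain M j ω ≤ X.gain M i ω} := fun i => by
    simp only [Set.ofPred_forall]
    exact MeasurableSet.iInter fun j => measurableSet_le (hX.gain hM j) (hX.gain hM i)
  refine measurable_to_countable' fun n => ?_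
  -- The second set of the union accounts for `sInf ∅ = 0`, when no BS attains the largest gain.
  have h : X.serving M ⁻¹' {n} =
      ({ω | ∀ j, X.gain M j ω ≤ X.gain M n ω} ∩
        ⋂ k, ⋂ _ : k < n, {ω | ∀ j, X.gain M j ω ≤ X.gain M k ω}ᶜ) ∪
      {ω | n = 0} ∩ ⋂ k, {ω | ∀ j, X.gain M j ω ≤ X.gain M k ω}ᶜ := by
    ext ω
    simp only [Set.mem_preimage, Set.mem_singleton_iff, Network.serving, Set.mem_union,
      Set.mem_inter_iff, Set.mem_iInter, Set.mem_compl_iff, Set.mem_ofPred_eq]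
    by_cases hne : ∃ k, k ∈ {i | ∀ j, X.gain M j ω ≤ X.gain M i ω}
    · classical
      rw [Nat.sInf_def hne, Nat.find_eq_iff]
      simp only [Set.mem_ofPred_eq]
      refine ⟨fun h => Or.inl h, ?_⟩
      rintro (h | ⟨-, h⟩)
      · exact h
      · obtain ⟨k, hk⟩ := hne
        exact absurd hk (h k)
    · have he : {i | ∀ j, X.gain M j ω ≤ X.gain M i ω} = ∅ :=
        Set.eq_empty_iff_forall_notMem.2 fun k hk => hne ⟨k, hk⟩
      rw [he, Nat.sInf_empty]
      push Not at hne
      constructor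
      · intro h
        exact Or.inr ⟨h.symm, fun k hk => hne k hk⟩
      · rintro (⟨h, -⟩ | ⟨h, -⟩)
        · exact absurd h (hne n)
        · exact h.symm
  rw [h]
  exact ((hp n).inter (MeasurableSet.iInter fun k => MeasurableSet.iInter fun _ =>
    (hp k).compl)).union ((MeasurableSet.const _).inter (MeasurableSet.iInter fun k => (hp k).compl))

lemma gain_serving (hX : X.IsMeasurable) (hM : M.Admissible) : Measurable fun ω => X.gain M (X.serving M ω) ω :=
  (measurable_from_prod_countable_right (f := fun p : ℕ × Ω => X.gain M p.1 p.2)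
    fun i => hX.gain hM i).comp ((hX.serving hM).prodMk measurable_id)

lemma interference (hX : X.IsMeasurable) (hM : M.Admissible) : Measurable (X.interference M) := by
  refine Measurable.tsum fun i => Measurable.ite ?_
    (((hX.gain hM i).const_mul _).mul (hX.g i)).ennreal_ofReal measurable_const
  refine (hX.active i (measurableSet_singleton true)).inter (s₂ := {ω | i ≠ X.serving M ω}) ?_
  have h : {ω | i ≠ X.serving M ω} = (X.serving M ⁻¹' {i})ᶜ := by
    ext ω
    simp [eq_comm]
  rw [h]
  exact ((hX.serving hM) (measurableSet_singleton i)).compl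

lemma load (hX : X.IsMeasurable) (hM : M.Admissible) : Measurable (X.load M) :=
  ((hX.interference hM).add_const _).div (((hX.gain_serving hM).const_mul _).ennreal_ofReal)

lemma sinr (hX : X.IsMeasurable) (hM : M.Admissible) : Measurable (X.sinr M) :=
  ((((hX.gain_serving hM).const_mul _).mul hX.h).ennreal_ofReal.div
    ((hX.interference hM).add_const _)).ennreal_toReal

end IsMeasurable

/-- The randomness of a network except for the fading of the serving link. -/
abbrev Environment : Type := ((ℕ → Plane × Bool) × (ℕ → ℝ)) × (ℕ → ℝ)

/-- The network on its environment, with trivial fading of the serving link. -/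
def canonical : Network Environment where
  pos i z := (z.1.1 i).1
  active i z := (z.1.1 i).2
  mark i z := z.1.2 i
  g i z := z.2 i
  h _ := 0

lemma canonical_isMeasurable : canonical.IsMeasurable where
  pos i := by unfold canonical; fun_prop
  active i := by unfold canonical; fun_prop
  mark i := by unfold canonical; fun_prop
  g i := by unfold canonical; fun_prop
  h := measurable_const

/-- The environment of the typical user. -/
def environment {Ω : Type*} (X : Network Ω) (ω : Ω) : Environment :=
  ((fun i => (X.pos i ω, X.active i ω), fun i => X.mark i ω), fun i => X.g i ω)

/-- The load does not involve `h`: it is a fixed measurable function of the environment, so `h` can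
be integrated out by Fubini. -/
lemma load_eq_canonical {Ω : Type*} (X : Network Ω) (M : RadioModel) (ω : Ω) : X.load M ω = canonical.load M (X.environment ω) := rfl

variable {μ : Measure Ω} {l ρ : ℝ}

namespace IsModel

lemma isMeasurable (hX : X.IsModel M μ l ρ) : X.IsMeasurable :=
  ⟨hX.meas_pos, hX.meas_active, hX.meas_mark, hX.meas_g, hX.meas_h⟩

lemma measurable_bs (hX : X.IsModel M μ l ρ) : Measurable fun ω i => (X.pos i ω, X.active i ω) :=
  measurable_pi_lambda _ fun i => (hX.meas_pos i).prodMk (hX.meas_active i)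

lemma measurable_marks (hX : X.IsModel M μ l ρ) : Measurable fun ω i => X.mark i ω :=
  measurable_pi_lambda _ hX.meas_mark

lemma measurable_fadings (hX : X.IsModel M μ l ρ) : Measurable fun ω i => X.g i ω :=
  measurable_pi_lambda _ hX.meas_g

lemma indep_bs_mark (hX : X.IsModel M μ l ρ) :
    IndepFun (fun ω i => (X.pos i ω, X.active i ω)) (fun ω i => X.mark i ω) μ :=
  hX.indep_bs.comp (φ := id) (ψ := Prod.fst) measurable_id measurable_fst

lemma measurable_environment (hX : X.IsModel M μ l ρ) : Measurable X.environment :=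
  (hX.measurable_bs.prodMk hX.measurable_marks).prodMk hX.measurable_fadings

variable [IsProbabilityMeasure μ]

lemma indep_bs_mark_fading (hX : X.IsModel M μ l ρ) :
    IndepFun (fun ω => ((fun i => (X.pos i ω, X.active i ω)), fun i => X.mark i ω))
      (fun ω => ((fun i => X.g i ω), X.h ω)) μ :=
  indepFun_prodMk_left hX.measurable_bs hX.measurable_marks
    (hX.measurable_fadings.prodMk hX.meas_h) hX.indep_bs hX.indep_mark

lemma indep_bs_mark_g (hX : X.IsModel M μ l ρ) :
    IndepFun (fun ω => ((fun i => (X.pos i ω, X.active i ω)), fun i => X.mark i ω))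
      (fun ω i => X.g i ω) μ :=
  hX.indep_bs_mark_fading.comp (φ := id) (ψ := Prod.fst) measurable_id measurable_fst

lemma indep_environment (hX : X.IsModel M μ l ρ) : IndepFun X.environment X.h μ :=
  indepFun_prodMk_left (hX.measurable_bs.prodMk hX.measurable_marks) hX.measurable_fadings
    hX.meas_h hX.indep_bs_mark_fading hX.indep_fading

/-- Integrating out the fading of the serving link. -/
lemma measure_environment_h (hX : X.IsModel M μ l ρ) {A : Set (Environment × ℝ)}
    (hA : MeasurableSet A) :
    μ {ω | (X.environment ω, X.h ω) ∈ A} =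
      ∫⁻ ω, expMeasure 1 {x | (X.environment ω, x) ∈ A} ∂μ := by
  have := isProbabilityMeasure_expMeasure (r := 1) one_pos
  have h := hX.indep_environment.map_prod_eq_prod_map_map
    hX.measurable_environment.aemeasurable hX.meas_h.aemeasurable
  rw [hX.h_law] at h
  have h1 : μ {ω | (X.environment ω, X.h ω) ∈ A} =
      μ.map (fun ω => (X.environment ω, X.h ω)) A :=
    (Measure.map_apply (hX.measurable_environment.prodMk hX.meas_h) hA).symm
  rw [h1, h, Measure.prod_apply hA,
    lintegral_map (measurable_measure_prodMk_left hA) hX.measurable_environment]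
  rfl

lemma measure_lt_sinr (hX : X.IsModel M μ l ρ) (hM : M.Admissible) (hL : 0 < M.L) {γ : ℝ}
    (hγ : 0 < γ) :
    μ {ω | γ < X.sinr M ω} = ∫⁻ ω, nexp (ENNReal.ofReal γ * X.load M ω) ∂μ := by
  have h := hX.measure_environment_h
    (A := {p | ENNReal.ofReal γ * canonical.load M p.1 < ENNReal.ofReal p.2})
    (measurableSet_lt (((canonical_isMeasurable.load hM).comp measurable_fst).const_mul _)
      measurable_snd.ennreal_ofReal)
  simp only [lt_sinr_iff hM hL hγ]
  refine h.trans (lintegral_congr fun ω => ?_)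
  rw [load_eq_canonical]
  exact expMeasure_lt_ofReal (ENNReal.ofReal γ * canonical.load M (X.environment ω))

/-- Given the environment, the SINR is a constant multiple of an exponential variable. The constant
is `0` when the load is infinite, so an atom at `0` is possible and only `(0, ∞)` is considered. -/
lemma map_sinr_restrict_absolutelyContinuous (hX : X.IsModel M μ l ρ) (hM : M.Admissible)
    (hL : 0 < M.L) : (μ.map (X.sinr M)).restrict (Set.Ioi 0) ≪ volume := by
  refine Measure.AbsolutelyContinuous.mk fun A hA hA0 => ?_
  rw [Measure.restrict_apply hA, Measure.map_apply (hX.isMeasurable.sinr hM)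
    (hA.inter measurableSet_Ioi)]
  have hc := (canonical_isMeasurable.load hM).inv.ennreal_toReal
  have h := hX.measure_environment_h
    (A := {p | (canonical.load M p.1)⁻¹.toReal ≠ 0 ∧ (canonical.load M p.1)⁻¹.toReal * p.2 ∈ A})
    (((hc.comp measurable_fst) (measurableSet_singleton 0)).compl.inter
      (((hc.comp measurable_fst).mul measurable_snd) hA))
  refine measure_mono_null ?_ (h.trans ?_)
  · rintro ω ⟨hω, hω0⟩
    have h1 : 0 < X.sinr M ω := hω0
    have h2 : X.sinr M ω = (ENNReal.ofReal (X.h ω)).toReal * (X.load M ω)⁻¹.toReal := by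
      rw [sinr_eq hM hL, div_eq_mul_inv, ENNReal.toReal_mul]
    have h3 : (ENNReal.ofReal (X.h ω)).toReal = X.h ω := by
      refine ENNReal.toReal_ofReal (le_of_not_gt fun hneg => ?_)
      rw [h2, ENNReal.ofReal_of_nonpos hneg.le] at h1
      simp at h1
    rw [h3, mul_comm] at h2
    refine ⟨fun h4 => ?_, ?_⟩
    · have h5 : (X.load M ω)⁻¹.toReal = 0 := h4
      rw [h2, h5, zero_mul] at h1
      exact h1.false
    · change (X.load M ω)⁻¹.toReal * X.h ω ∈ A
      rwa [← h2]
  · refine lintegral_eq_zero_of_ae_eq_zero (ae_of_all _ fun ω => ?_)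
    refine expMeasure_absolutelyContinuous 1 ?_
    -- Slope zero is excluded from the event; any other slope pulls null sets back to null sets.
    by_cases h0 : (canonical.load M (X.environment ω))⁻¹.toReal = 0
    · exact measure_mono_null (t := ∅) (fun x hx => hx.1 h0) (by simp)
    · refine measure_mono_null (fun x hx => hx.2) ?_
      have := Real.volume_preimage_mul_left h0 A
      rw [hA0, mul_zero] at this
      exact this

end IsModel

end Network

/-! ### The Laplace transform of the total interference. -/

lemma setLIntegral_Icc_ite_le {p : ℝ} (hp : p ∈ Set.Icc (0 : ℝ) 1) (α β : ℝ≥0∞) :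
    ∫⁻ t in Set.Icc (0 : ℝ) 1, (if t ≤ p then α else β) =
      ENNReal.ofReal p * α + ENNReal.ofReal (1 - p) * β := by
  have h1 : Set.Icc (0 : ℝ) 1 = Set.Icc 0 p ∪ Set.Ioc p 1 := (Set.Icc_union_Ioc_eq_Icc hp.1 hp.2).symm
  rw [h1, lintegral_union measurableSet_Ioc
    (Set.disjoint_left.2 fun t ht ht' => absurd ht.2 (not_le.2 ht'.1)),
    setLIntegral_congr_fun (g := fun _ => α) measurableSet_Icc fun t ht => if_pos ht.2,
    setLIntegral_congr_fun (g := fun _ => β) measurableSet_Ioc fun t ht => if_neg (not_le.2 ht.1)]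
  simp [mul_comm]

namespace RadioModel

variable {M : RadioModel}

/-- The exponent of the Laplace transform of the interference, per unit of density. -/
noncomputable def interfExponent (M : RadioModel) (s : ℝ) : ℝ≥0∞ :=
  ENNReal.ofReal (2 * Real.pi) *
    (M.interfIntegral M.prLoS M.gainL s + M.interfIntegral (fun w => 1 - M.prLoS w) M.gainNL s)

/-- Pointwise, `c x / (1 + c x) ≤ c * (x / (1 + x))` for `c ≥ 1` and `x ≥ 0`. This replaces
continuity of the exponent in `s`, also where it is infinite. -/
lemma interfIntegral_mul_le (hM : M.Admissible) {p ζ : ℝ → ℝ} (hp : ∀ w, M.L ≤ w → 0 ≤ p w)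
    (hζ : ∀ w, M.L ≤ w → 0 ≤ ζ w) {s c : ℝ} (hs : 0 ≤ s) (hc : 1 ≤ c) :
    M.interfIntegral p ζ (c * s) ≤ ENNReal.ofReal c * M.interfIntegral p ζ s := by
  rw [interfIntegral, interfIntegral, ← lintegral_const_mul' _ _ ENNReal.ofReal_ne_top]
  refine setLIntegral_mono' measurableSet_Ioi fun u hu => ?_
  rw [← ENNReal.ofReal_mul (by linarith)]
  refine ENNReal.ofReal_le_ofReal ?_
  have h1 : 0 ≤ p (M.dist3 u) * u := mul_nonneg (hp _ (M.le_dist3 u)) (le_of_lt hu)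
  have h2 : 0 ≤ s * M.P * ζ (M.dist3 u) :=
    mul_nonneg (mul_nonneg hs hM.P_pos.le) (hζ _ (M.le_dist3 u))
  have h3 : c * s * M.P * ζ (M.dist3 u) / (1 + c * s * M.P * ζ (M.dist3 u)) ≤
      c * (s * M.P * ζ (M.dist3 u) / (1 + s * M.P * ζ (M.dist3 u))) := by
    rw [show c * s * M.P * ζ (M.dist3 u) = c * (s * M.P * ζ (M.dist3 u)) by ring, mul_div_assoc]
    refine mul_le_mul_of_nonneg_left ?_ (by linarith)
    refine div_le_div_of_nonneg_left h2 (by linarith) ?_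
    nlinarith
  calc _ ≤ p (M.dist3 u) * u *
        (c * (s * M.P * ζ (M.dist3 u) / (1 + s * M.P * ζ (M.dist3 u)))) :=
        mul_le_mul_of_nonneg_left h3 h1
    _ = _ := by ring

lemma interfExponent_mul_le (hM : M.Admissible) (hL : 0 < M.L) {s c : ℝ} (hs : 0 ≤ s) (hc : 1 ≤ c) :
    M.interfExponent (c * s) ≤ ENNReal.ofReal c * M.interfExponent s := by
  rw [interfExponent, interfExponent, mul_left_comm, mul_add (ENNReal.ofReal c)]
  gcongr
  · exact interfIntegral_mul_le hM (fun w hw => (hM.prLoS_mem w hw).1)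
      (fun w hw => (hM.gainL_pos (hL.trans_le hw)).le) hs hc
  · exact interfIntegral_mul_le hM (fun w hw => sub_nonneg.2 (hM.prLoS_mem w hw).2)
      (fun w hw => (hM.gainNL_pos (hL.trans_le hw)).le) hs hc

lemma one_sub_mark_average {p a b : ℝ} (hp : p ∈ Set.Icc (0 : ℝ) 1) (ha : 0 ≤ a) (hb : 0 ≤ b) :
    1 - (ENNReal.ofReal p * ENNReal.ofReal (1 / (1 + a)) +
      ENNReal.ofReal (1 - p) * ENNReal.ofReal (1 / (1 + b))) =
    ENNReal.ofReal (p * (a / (1 + a)) + (1 - p) * (b / (1 + b))) := by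
  have hp0 := hp.1
  have hp1 : 0 ≤ 1 - p := sub_nonneg.2 hp.2
  rw [← ENNReal.ofReal_mul hp0, ← ENNReal.ofReal_mul hp1, ← ENNReal.ofReal_add (by positivity)
    (by positivity), ← ENNReal.ofReal_one, ← ENNReal.ofReal_sub _ (by positivity)]
  congr 1
  field_simp
  ring

/-- The Laplace transform of the interference from a BS at `x`, averaged over marks and fading. -/
noncomputable def linkLaplace (M : RadioModel) (s : ℝ) (x : Plane) : ℝ≥0∞ :=
  ∫⁻ t in Set.Icc (0 : ℝ) 1, ENNReal.ofReal (1 / (1 + s * M.P * M.linkGain x t))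

/-- Averaging over the mark splits the integrand into its LoS and NLoS parts, which depend on `‖x‖`
only; polar coordinates do the rest. -/
lemma lintegral_one_sub_linkLaplace (hM : M.Admissible) (hL : 0 < M.L) {s : ℝ} (hs : 0 ≤ s) :
    ∫⁻ x, (1 - M.linkLaplace s x) = M.interfExponent s := by
  obtain ⟨p, hp, hpeq⟩ := hM.exists_measurable_prLoS
  let a : ℝ → ℝ := fun u => s * M.P * M.gainL (M.dist3 u)
  let b : ℝ → ℝ := fun u => s * M.P * M.gainNL (M.dist3 u)
  have ha : ∀ u, 0 ≤ a u := fun u => mul_nonneg (mul_nonneg hs hM.P_pos.le)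
    (hM.gainL_pos (hL.trans_le (M.le_dist3 u))).le
  have hb : ∀ u, 0 ≤ b u := fun u => mul_nonneg (mul_nonneg hs hM.P_pos.le)
    (hM.gainNL_pos (hL.trans_le (M.le_dist3 u))).le
  have hpm : ∀ u, p (M.dist3 u) ∈ Set.Icc (0 : ℝ) 1 := fun u =>
    hpeq _ (M.le_dist3 u) ▸ hM.prLoS_mem _ (M.le_dist3 u)
  have hd := M.continuous_dist3.measurable
  have ham : Measurable a := (M.measurable_gainL.comp hd).const_mul _
  have hbm : Measurable b := (M.measurable_gainNL.comp hd).const_mul _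
  have hpd : Measurable fun u => p (M.dist3 u) := hp.comp hd
  have h1 : ∀ x : Plane, 1 - M.linkLaplace s x =
      ENNReal.ofReal (p (M.dist3 ‖x‖) * (a ‖x‖ / (1 + a ‖x‖)) +
        (1 - p (M.dist3 ‖x‖)) * (b ‖x‖ / (1 + b ‖x‖))) := by
    intro x
    rw [← one_sub_mark_average (hpm _) (ha _) (hb _), ← setLIntegral_Icc_ite_le (hpm _)]
    congr 1
    refine lintegral_congr fun t => ?_
    simp only [linkGain, hpeq _ (M.le_dist3 ‖x‖)]
    split_ifs <;> rfl
  have hm1 : Measurable fun u => p (M.dist3 u) * (a u / (1 + a u)) +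
      (1 - p (M.dist3 u)) * (b u / (1 + b u)) := by fun_prop
  rw [lintegral_congr h1, lintegral_plane_norm hm1.ennreal_ofReal, interfExponent]
  congr 1
  rw [interfIntegral, interfIntegral]
  have hm2 : Measurable fun u => ENNReal.ofReal (p (M.dist3 u) * u * (a u / (1 + a u))) := by
    fun_prop
  simp only [hpeq _ (M.le_dist3 _)]
  rw [← lintegral_add_left hm2]
  refine setLIntegral_congr_fun measurableSet_Ioi fun u hu => ?_
  have hu0 : 0 ≤ u := le_of_lt hu
  have h2 := (hpm u).1
  have h3 : 0 ≤ 1 - p (M.dist3 u) := sub_nonneg.2 (hpm u).2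
  have h4 := ha u
  have h5 := hb u
  have e1 : 0 ≤ a u / (1 + a u) := div_nonneg h4 (by linarith)
  have e2 : 0 ≤ b u / (1 + b u) := div_nonneg h5 (by linarith)
  rw [← ENNReal.ofReal_mul hu0]
  change _ = ENNReal.ofReal (p (M.dist3 u) * u * (a u / (1 + a u))) +
    ENNReal.ofReal ((1 - p (M.dist3 u)) * u * (b u / (1 + b u)))
  rw [← ENNReal.ofReal_add (mul_nonneg (mul_nonneg h2 hu0) e1) (mul_nonneg (mul_nonneg h3 hu0) e2)]
  congr 1
  ring

end RadioModel

namespace Network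

variable {Ω : Type*} [MeasurableSpace Ω] {X : Network Ω} {M : RadioModel}

/-- The interference from all active BSs, including the serving one if it is active. -/
noncomputable def totalInterference {Ω : Type*} (X : Network Ω) (M : RadioModel) (ω : Ω) : ℝ≥0∞ :=
  ∑' i, if X.active i ω = true then ENNReal.ofReal (M.P * X.gain M i ω * X.g i ω) else 0

lemma interference_eq_totalInterference {Ω : Type*} (X : Network Ω) (M : RadioModel) {ω : Ω}
    (h : X.active (X.serving M ω) ω ≠ true) :
    X.interference M ω = X.totalInterference M ω := by
  refine tsum_congr fun i => if_congr (and_iff_left_of_imp ?_) rfl rfl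
  rintro hi rfl
  exact h hi

variable {μ : Measure Ω} [IsProbabilityMeasure μ] {l ρ : ℝ}

namespace IsModel

/-- The transform is an infinite product over BSs. Fadings are averaged first (`h2`), then marks
(`h4`), leaving a product of a function of the active positions, to which the generating functional
applies (`h6`). -/
lemma lintegral_nexp_totalInterference (hX : X.IsModel M μ l ρ) (hM : M.Admissible) (hL : 0 < M.L)
    {s : ℝ} (hs : 0 ≤ s) :
    ∫⁻ ω, nexp (ENNReal.ofReal s * X.totalInterference M ω) ∂μ =
      nexp (ENNReal.ofReal (M.activeDensity ρ l) * M.interfExponent s) := by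
  have hgain : ∀ x t, 0 ≤ s * M.P * M.linkGain x t := fun x t =>
    mul_nonneg (mul_nonneg hs hM.P_pos.le) (hM.linkGain_pos hL x t).le
  have h1 : ∀ ω, nexp (ENNReal.ofReal s * X.totalInterference M ω) =
      infProd fun i => if X.active i ω = true then
        nexp (ENNReal.ofReal (s * M.P * M.linkGain (X.pos i ω) (X.mark i ω) * X.g i ω)) else 1 := by
    intro ω
    rw [totalInterference, ← ENNReal.tsum_mul_left, nexp_tsum]
    congr 1
    ext i
    split_ifs
    · rw [← ENNReal.ofReal_mul hs, gain_eq]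
      congr 2
      ring
    · rw [mul_zero, nexp_zero]
  have h2 := lintegral_infProd_of_indep (hX.measurable_bs.prodMk hX.measurable_marks) hX.meas_g
    hX.g_indep hX.indep_bs_mark_g
    (F := fun i u t => if (u.1 i).2 = true then
        nexp (ENNReal.ofReal (s * M.P * M.linkGain (u.1 i).1 (u.2 i) * t)) else 1)
    (fun i => by
      have hg : Measurable fun y : ((ℕ → Plane × Bool) × (ℕ → ℝ)) × ℝ =>
          M.linkGain (y.1.1 i).1 (y.1.2 i) :=
        hM.measurable_linkGain_comp (by fun_prop) (by fun_prop)
      refine Measurable.ite ?_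
        (measurable_nexp.comp ((hg.const_mul _).mul measurable_snd).ennreal_ofReal) measurable_const
      have : Measurable fun y : ((ℕ → Plane × Bool) × (ℕ → ℝ)) × ℝ => (y.1.1 i).2 := by fun_prop
      exact this (measurableSet_singleton true))
    (fun i u t => by split_ifs; exacts [nexp_le_one _, le_rfl])
  have h3 : ∀ ω i, ∫⁻ ω', (if X.active i ω = true then
      nexp (ENNReal.ofReal (s * M.P * M.linkGain (X.pos i ω) (X.mark i ω) * X.g i ω')) else 1) ∂μ =
      if X.active i ω = true then
        ENNReal.ofReal (1 / (1 + s * M.P * M.linkGain (X.pos i ω) (X.mark i ω))) else 1 := by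
    intro ω i
    split_ifs
    · rw [← lintegral_expMeasure_nexp (hgain _ _), ← hX.g_law i]
      exact (lintegral_map (f := fun x =>
        nexp (ENNReal.ofReal (s * M.P * M.linkGain (X.pos i ω) (X.mark i ω) * x)))
        (measurable_nexp.comp (by fun_prop)) (hX.meas_g i)).symm
    · simp
  have hmeas : ∀ {S : Type} [MeasurableSpace S] {f : S → Plane} {g : S → ℝ}, Measurable f →
      Measurable g → Measurable fun y => ENNReal.ofReal (1 / (1 + s * M.P * M.linkGain (f y) (g y))) :=
    fun hf hg => by
      have := hM.measurable_linkGain_comp hf hg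
      fun_prop
  have hle : ∀ x t, ENNReal.ofReal (1 / (1 + s * M.P * M.linkGain x t)) ≤ 1 := fun x t => by
    have := hgain x t
    rw [← ENNReal.ofReal_one]
    exact ENNReal.ofReal_le_ofReal (div_le_one_of_le₀ (by linarith) (by linarith))
  have h4 := lintegral_infProd_of_indep hX.measurable_bs hX.meas_mark
    hX.mark_indep hX.indep_bs_mark
    (F := fun i u t => if (u i).2 = true then
        ENNReal.ofReal (1 / (1 + s * M.P * M.linkGain (u i).1 t)) else 1)
    (fun i => by
      refine Measurable.ite ?_ (hmeas (by fun_prop) measurable_snd) measurable_const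
      have : Measurable fun y : (ℕ → Plane × Bool) × ℝ => (y.1 i).2 := by fun_prop
      exact this (measurableSet_singleton true))
    (fun i u t => by split_ifs; exacts [hle _ _, le_rfl])
  have h5 : ∀ ω i, ∫⁻ ω', (if X.active i ω = true then
      ENNReal.ofReal (1 / (1 + s * M.P * M.linkGain (X.pos i ω) (X.mark i ω'))) else 1) ∂μ =
      if X.active i ω = true then M.linkLaplace s (X.pos i ω) else 1 := by
    intro ω i
    split_ifs
    · rw [RadioModel.linkLaplace, ← hX.mark_law i]
      exact (lintegral_map (hmeas measurable_const measurable_id) (hX.meas_mark i)).symm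
    · simp
  have h6 := hX.active_hppp.lintegral_infProd hX.meas_pos hX.meas_active (v := M.linkLaplace s)
    ((hmeas (S := Plane × ℝ) measurable_fst measurable_snd).lintegral_prod_right')
    (fun x => (lintegral_mono fun t => hle x t).trans (by simp))
  simp only [h3] at h2
  simp only [h5] at h4
  rw [lintegral_congr h1, h2, h4, h6, RadioModel.lintegral_one_sub_linkLaplace hM hL hs]

end IsModel

end Network

/-! ### The bad event and the two-sided bound on coverage. -/

lemma Measurable.nexp {Ω : Type*} [MeasurableSpace Ω] {f : Ω → ℝ≥0∞} (hf : Measurable f) :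
    Measurable fun ω => nexp (f ω) :=
  measurable_nexp.comp hf

lemma infProd_ite (P : ℕ → Prop) [DecidablePred P] [Decidable (∀ i, ¬ P i)] :
    infProd (fun i => if P i then 0 else 1) = if ∀ i, ¬ P i then 1 else 0 := by
  split_ifs with h
  · simp [infProd, h]
  · push Not at h
    obtain ⟨i, hi⟩ := h
    refine le_antisymm ((iInf_le _ (i + 1)).trans (le_of_eq ?_)) zero_le
    exact Finset.prod_eq_zero (Finset.self_mem_range_succ i) (if_pos hi)

lemma IsHPPP.measure_void {Ω : Type*} [MeasurableSpace Ω] {μ : Measure Ω} {b : ℕ → Ω → Plane}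
    {sel : ℕ → Ω → Bool} {dens : ℝ} (H : IsHPPP μ b sel dens) {B : Set Plane}
    (hB : MeasurableSet B) (hvB : volume B ≠ ∞) :
    μ {ω | pointCount b sel B ω = 0} = nexp (ENNReal.ofReal dens * volume B) := by
  have h := H.poisson B hB hvB 0
  rw [Nat.cast_zero, poissonMeasure_singleton] at h
  rw [h]
  have h1 : ENNReal.ofReal dens * volume B = ENNReal.ofReal (dens * (volume B).toReal) := by
    rw [ENNReal.ofReal_mul' ENNReal.toReal_nonneg, ENNReal.ofReal_toReal hvB]
  rw [h1, nexp_eq_ofReal ENNReal.ofReal_ne_top]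
  simp [Real.coe_toNNReal', ENNReal.toReal_ofReal']

namespace Network

variable {Ω : Type*} {X : Network Ω} {M : RadioModel}

/-- No BS within distance `r` has a mark of at most `p`. -/
def farEvent (X : Network Ω) (r p : ℝ) : Set Ω :=
  {ω | ∀ i, ¬ (X.pos i ω ∈ Metric.ball (0 : Plane) r ∧ X.mark i ω ≤ p)}

/-- The exceptional event that the serving BS may be weaker than `t` or active: there is no BS
within distance `r` with a mark of at most `p`, or there is an active BS in `M.strongSet t`, or
there are infinitely many BSs in `M.strongSet t`. -/
def badEvent (X : Network Ω) (M : RadioModel) (t r p : ℝ) : Set Ω :=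
  X.farEvent r p ∪ {ω | pointCount X.pos X.active (M.strongSet t) ω = 0}ᶜ ∪
    (⋃ k : ℕ, {ω | pointCount X.pos (fun _ _ => true) (M.strongSet t) ω = k})ᶜ

/-- A near BS with a small mark has gain at least `t`, and finiteness in `strongSet t` makes the
largest gain attained. The serving BS then lies in `strongSet t`, where nothing is active. -/
lemma gain_serving_of_notMem_badEvent {t r p : ℝ}
    (hnear : ∀ x : ℝ, |x| < r → p ≤ M.prLoS (M.dist3 x) ∧ t ≤ M.gainL (M.dist3 x)) {ω : Ω}
    (hω : ω ∉ X.badEvent M t r p) :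
    t ≤ X.gain M (X.serving M ω) ω ∧ X.active (X.serving M ω) ω ≠ true := by
  simp only [badEvent, Set.mem_union, not_or, Set.mem_compl_iff, not_not] at hω
  obtain ⟨⟨h1, h2⟩, h3⟩ := hω
  have hmem : ∀ j, t ≤ X.gain M j ω → X.pos j ω ∈ M.strongSet t := by
    intro j hj
    refine hj.trans ?_
    rw [gain_eq, RadioModel.linkGain]
    split_ifs
    exacts [le_max_left _ _, le_max_right _ _]
  obtain ⟨i, hi, hip⟩ : ∃ i, X.pos i ω ∈ Metric.ball (0 : Plane) r ∧ X.mark i ω ≤ p := by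
    by_contra hne
    exact h1 fun i hi => hne ⟨i, hi⟩
  have hit : t ≤ X.gain M i ω := by
    obtain ⟨h4, h5⟩ := hnear ‖X.pos i ω‖ (by simpa using hi)
    rw [gain_eq, RadioModel.linkGain, if_pos (hip.trans h4)]
    exact h5
  obtain ⟨k, hk⟩ := Set.mem_iUnion.1 h3
  have hfin : {j | true = true ∧ X.pos j ω ∈ M.strongSet t}.Finite :=
    Set.finite_of_encard_eq_coe hk
  obtain ⟨o, -, ho⟩ := Set.exists_max_image _ (fun j => X.gain M j ω) hfin
    ⟨i, rfl, hmem i hit⟩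
  -- BSs outside the finite set have gain below `t`, so its maximum is global and the `sInf` in
  -- `serving` is attained rather than a default.
  have hne : {i | ∀ j, X.gain M j ω ≤ X.gain M i ω}.Nonempty := by
    refine ⟨o, fun j => ?_⟩
    by_cases hj : t ≤ X.gain M j ω
    · exact ho j ⟨rfl, hmem j hj⟩
    · exact (not_le.1 hj).le.trans (hit.trans (ho i ⟨rfl, hmem i hit⟩))
  have hs : ∀ j, X.gain M j ω ≤ X.gain M (X.serving M ω) ω := Nat.sInf_mem hne
  have hst := hit.trans (hs i)
  refine ⟨hst, fun hact => ?_⟩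
  have h4 : {j | X.active j ω = true ∧ X.pos j ω ∈ M.strongSet t} = ∅ := Set.encard_eq_zero.1 h2
  have h5 : X.serving M ω ∈ {j | X.active j ω = true ∧ X.pos j ω ∈ M.strongSet t} :=
    ⟨hact, hmem _ hst⟩
  rw [h4] at h5
  exact h5

lemma le_load_mul_of_notMem_badEvent (hM : M.Admissible) (hL : 0 < M.L) {t r p : ℝ}
    (hnear : ∀ x : ℝ, |x| < r → p ≤ M.prLoS (M.dist3 x) ∧ t ≤ M.gainL (M.dist3 x)) {ω : Ω}
    (hω : ω ∉ X.badEvent M t r p) (γ : ℝ) :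
    ENNReal.ofReal (γ / (M.P * M.peakGain)) *
      (X.totalInterference M ω + ENNReal.ofReal M.PN) ≤ ENNReal.ofReal γ * X.load M ω := by
  obtain ⟨-, h2⟩ := gain_serving_of_notMem_badEvent hnear hω
  have h : 0 < M.P * M.peakGain := mul_pos hM.P_pos (hM.peakGain_pos hL)
  rw [load, interference_eq_totalInterference X M h2, ENNReal.ofReal_div_of_pos h,
    ENNReal.div_eq_inv_mul, ENNReal.div_eq_inv_mul, mul_comm (_⁻¹) (ENNReal.ofReal γ), mul_assoc]
  gcongr
  · exact hM.P_pos.le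
  · exact hM.linkGain_le _ _

lemma load_mul_le_of_notMem_badEvent (hM : M.Admissible) {t r p : ℝ} (ht : 0 < t)
    (hnear : ∀ x : ℝ, |x| < r → p ≤ M.prLoS (M.dist3 x) ∧ t ≤ M.gainL (M.dist3 x)) {ω : Ω}
    (hω : ω ∉ X.badEvent M t r p) (γ : ℝ) :
    ENNReal.ofReal γ * X.load M ω ≤ ENNReal.ofReal (γ / (M.P * t)) *
      (X.totalInterference M ω + ENNReal.ofReal M.PN) := by
  obtain ⟨h1, h2⟩ := gain_serving_of_notMem_badEvent hnear hω
  rw [load, interference_eq_totalInterference X M h2, ENNReal.ofReal_div_of_pos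
    (mul_pos hM.P_pos ht), ENNReal.div_eq_inv_mul, ENNReal.div_eq_inv_mul,
    mul_comm (_⁻¹) (ENNReal.ofReal γ), mul_assoc]
  gcongr
  exact hM.P_pos.le

variable [MeasurableSpace Ω] {μ : Measure Ω}

lemma IsMeasurable.totalInterference (hX : X.IsMeasurable) (hM : M.Admissible) :
    Measurable (X.totalInterference M) :=
  Measurable.tsum fun i => Measurable.ite (hX.active i (measurableSet_singleton true))
    (((hX.gain hM i).const_mul _).mul (hX.g i)).ennreal_ofReal measurable_const

variable [IsProbabilityMeasure μ] {l ρ : ℝ}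

namespace IsModel

/-- Independent thinning by the marks: the near BSs with a mark at most `p` form a void event,
written as a product of `0`s and `1`s and averaged over marks before using the generating
functional. -/
lemma measure_farEvent (hX : X.IsModel M μ l ρ) {r p : ℝ} (hp : p ∈ Set.Icc (0 : ℝ) 1) :
    μ (X.farEvent r p) =
      nexp (ENNReal.ofReal l * (ENNReal.ofReal p * volume (Metric.ball (0 : Plane) r))) := by
  classical
  have hball : MeasurableSet (Metric.ball (0 : Plane) r) := measurableSet_ball
  have hset : MeasurableSet (X.farEvent r p) := by
    have : X.farEvent r p = ⋂ i, (X.pos i ⁻¹' Metric.ball (0 : Plane) r ∩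
        X.mark i ⁻¹' Set.Iic p)ᶜ := by
      ext ω
      simp [farEvent]
    rw [this]
    exact MeasurableSet.iInter fun i =>
      ((hX.meas_pos i hball).inter (hX.meas_mark i measurableSet_Iic)).compl
  have h1 : ∀ ω, (X.farEvent r p).indicator (fun _ => (1 : ℝ≥0∞)) ω =
      infProd fun i => if X.pos i ω ∈ Metric.ball (0 : Plane) r ∧ X.mark i ω ≤ p then 0 else 1 := by
    intro ω
    rw [infProd_ite, Set.indicator_apply]
    rfl
  have h2 := lintegral_infProd_of_indep hX.measurable_bs hX.meas_mark hX.mark_indep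
    hX.indep_bs_mark
    (F := fun i u t => if (u i).1 ∈ Metric.ball (0 : Plane) r ∧ t ≤ p then 0 else 1)
    (fun i => by
      refine Measurable.ite ?_ measurable_const measurable_const
      have : Measurable fun y : (ℕ → Plane × Bool) × ℝ => (y.1 i).1 := by fun_prop
      exact (this hball).inter (measurable_snd measurableSet_Iic))
    (fun i u t => by split_ifs; exacts [zero_le, le_rfl])
  -- The guard `true = true` puts the product in the form of `IsHPPP.lintegral_infProd` with every
  -- BS selected.
  have h3 : ∀ ω i, ∫⁻ ω', (if X.pos i ω ∈ Metric.ball (0 : Plane) r ∧ X.mark i ω' ≤ p then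
      (0 : ℝ≥0∞) else 1) ∂μ =
      if true = true then (if X.pos i ω ∈ Metric.ball (0 : Plane) r then ENNReal.ofReal (1 - p)
        else 1) else 1 := by
    intro ω i
    rw [if_pos rfl]
    split_ifs with h
    · simp only [h, true_and]
      have h4 := setLIntegral_Icc_ite_le hp 0 1
      rw [← hX.mark_law i, lintegral_map (Measurable.ite measurableSet_Iic measurable_const
        measurable_const) (hX.meas_mark i)] at h4
      rw [h4]
      simp
    · simp [h]
  have h5 := hX.bs_hppp.lintegral_infProd hX.meas_pos (fun _ => measurable_const)
    (v := fun x => if x ∈ Metric.ball (0 : Plane) r then ENNReal.ofReal (1 - p) else 1)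
    (Measurable.ite hball measurable_const measurable_const)
    (fun x => by
      split_ifs
      · exact ENNReal.ofReal_le_one.2 (by linarith [hp.1])
      · exact le_rfl)
  have h6 : ∀ x : Plane, (1 - if x ∈ Metric.ball (0 : Plane) r then ENNReal.ofReal (1 - p) else 1) =
      (Metric.ball (0 : Plane) r).indicator (fun _ => ENNReal.ofReal p) x := by
    intro x
    rw [Set.indicator_apply]
    split_ifs
    · rw [← ENNReal.ofReal_one, ← ENNReal.ofReal_sub _ (sub_nonneg.2 hp.2)]
      congr 1
      ring
    · simp
  rw [lintegral_congr fun ω => congrArg infProd (funext (h3 ω))] at h2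
  rw [lintegral_congr h6, lintegral_indicator_const hball] at h5
  rw [← h5, ← h2, ← lintegral_congr h1, lintegral_indicator_const hset, one_mul]

lemma measure_badEvent_le (hX : X.IsModel M μ l ρ) (hM : M.Admissible) {t r p : ℝ} (ht : 0 < t)
    (hp : p ∈ Set.Icc (0 : ℝ) 1) :
    μ (X.badEvent M t r p) ≤
      nexp (ENNReal.ofReal l * (ENNReal.ofReal p * volume (Metric.ball (0 : Plane) r))) +
        (1 - nexp (ENNReal.ofReal (M.activeDensity ρ l) * volume (M.strongSet t))) := by
  have hD := M.measurableSet_strongSet t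
  have hvD := hM.volume_strongSet_ne_top ht
  refine (measure_union_le _ _).trans ?_
  rw [hX.bs_hppp.measure_compl_iUnion_pointCount_eq hX.meas_pos (fun _ => measurable_const) hD hvD, add_zero]
  refine (measure_union_le _ _).trans (le_of_eq ?_)
  have hmeas : MeasurableSet {ω | pointCount X.pos X.active (M.strongSet t) ω = 0} :=
    measurable_pointCount hX.meas_pos hX.meas_active hD (measurableSet_singleton 0)
  rw [hX.measure_farEvent hp, prob_compl_eq_one_sub hmeas, ← hX.active_hppp.measure_void hD hvD]

lemma lintegral_nexp_totalInterference_add (hX : X.IsModel M μ l ρ) (hM : M.Admissible)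
    (hL : 0 < M.L) {s : ℝ} (hs : 0 ≤ s) :
    ∫⁻ ω, nexp (ENNReal.ofReal s * (X.totalInterference M ω + ENNReal.ofReal M.PN)) ∂μ =
      nexp (ENNReal.ofReal s * ENNReal.ofReal M.PN +
        ENNReal.ofReal (M.activeDensity ρ l) * M.interfExponent s) := by
  have h := hX.lintegral_nexp_totalInterference hM hL hs
  rw [nexp_add, ← h, ← lintegral_const_mul' _ _ (nexp_ne_top _)]
  refine lintegral_congr fun ω => ?_
  rw [mul_add, nexp_add, mul_comm]

lemma measure_lt_sinr_le (hX : X.IsModel M μ l ρ) (hM : M.Admissible) (hL : 0 < M.L) {t r p : ℝ}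
    (hnear : ∀ x : ℝ, |x| < r → p ≤ M.prLoS (M.dist3 x) ∧ t ≤ M.gainL (M.dist3 x))
    {γ : ℝ} (hγ : 0 < γ) :
    μ {ω | γ < X.sinr M ω} ≤
      nexp (ENNReal.ofReal (γ / (M.P * M.peakGain)) * ENNReal.ofReal M.PN +
        ENNReal.ofReal (M.activeDensity ρ l) * M.interfExponent (γ / (M.P * M.peakGain))) +
      μ (X.badEvent M t r p) := by
  have hs : 0 ≤ γ / (M.P * M.peakGain) :=
    div_nonneg hγ.le (mul_pos hM.P_pos (hM.peakGain_pos hL)).le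
  rw [hX.measure_lt_sinr hM hL hγ, ← hX.lintegral_nexp_totalInterference_add hM hL hs]
  refine le_trans ?_ (add_le_add_right (lintegral_indicator_one_le (X.badEvent M t r p)) _)
  rw [← lintegral_add_left 
    (((hX.isMeasurable.totalInterference hM).add_const _).const_mul _).nexp]
  refine lintegral_mono fun ω => ?_
  by_cases hω : ω ∈ X.badEvent M t r p
  · rw [Set.indicator_of_mem hω]
    exact (nexp_le_one _).trans le_add_self
  · rw [Set.indicator_of_notMem hω, add_zero]
    exact nexp_antitone (le_load_mul_of_notMem_badEvent hM hL hnear hω γ)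

/-- Off the bad event, replacing the serving gain by `t` instead of `peakGain` multiplies the
exponent by at most `peakGain / t`. -/
lemma le_measure_lt_sinr (hX : X.IsModel M μ l ρ) (hM : M.Admissible) (hL : 0 < M.L) {t r p : ℝ}
    (ht : 0 < t) (htp : t ≤ M.peakGain)
    (hnear : ∀ x : ℝ, |x| < r → p ≤ M.prLoS (M.dist3 x) ∧ t ≤ M.gainL (M.dist3 x))
    {γ : ℝ} (hγ : 0 < γ) :
    nexp (ENNReal.ofReal (M.peakGain / t) *
      (ENNReal.ofReal (γ / (M.P * M.peakGain)) * ENNReal.ofReal M.PN +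
        ENNReal.ofReal (M.activeDensity ρ l) * M.interfExponent (γ / (M.P * M.peakGain)))) -
      μ (X.badEvent M t r p) ≤ μ {ω | γ < X.sinr M ω} := by
  have hpk := hM.peakGain_pos hL
  have hP := hM.P_pos
  have hs : 0 ≤ γ / (M.P * M.peakGain) := by positivity
  have hc : 1 ≤ M.peakGain / t := (one_le_div ht).2 htp
  have hcs : γ / (M.P * t) = M.peakGain / t * (γ / (M.P * M.peakGain)) := by
    field_simp
  have hle : nexp (ENNReal.ofReal (M.peakGain / t) *
      (ENNReal.ofReal (γ / (M.P * M.peakGain)) * ENNReal.ofReal M.PN +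
        ENNReal.ofReal (M.activeDensity ρ l) * M.interfExponent (γ / (M.P * M.peakGain)))) ≤
      nexp (ENNReal.ofReal (γ / (M.P * t)) * ENNReal.ofReal M.PN +
        ENNReal.ofReal (M.activeDensity ρ l) * M.interfExponent (γ / (M.P * t))) := by
    refine nexp_antitone ?_
    rw [mul_add, hcs, ENNReal.ofReal_mul (by linarith : 0 ≤ M.peakGain / t), mul_assoc,
      mul_left_comm (ENNReal.ofReal (M.peakGain / t)) (ENNReal.ofReal (M.activeDensity ρ l))]
    gcongr
    exact RadioModel.interfExponent_mul_le hM hL hs hc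
  refine tsub_le_iff_right.2 (hle.trans ?_)
  rw [hX.measure_lt_sinr hM hL hγ,
    ← hX.lintegral_nexp_totalInterference_add hM hL (by positivity : 0 ≤ γ / (M.P * t))]
  refine le_trans ?_ (add_le_add_right (lintegral_indicator_one_le (X.badEvent M t r p)) _)
  rw [← lintegral_add_left ((hX.isMeasurable.load hM).const_mul _).nexp]
  refine lintegral_mono fun ω => ?_
  by_cases hω : ω ∈ X.badEvent M t r p
  · rw [Set.indicator_of_mem hω]
    exact (nexp_le_one _).trans le_add_self
  · rw [Set.indicator_of_notMem hω, add_zero]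
    exact nexp_antitone (load_mul_le_of_notMem_badEvent hM ht hnear hω γ)

end IsModel

end Network

/-! ### The limit of the coverage probability. -/

/-- Squeezing with iterated limits: first along `F` with `n` fixed, then in `n`. No uniformity in
`n` is required. -/
lemma tendsto_of_eventually_between {α : Type*} {F : Filter α} {f : α → ℝ≥0∞} {a : ℝ≥0∞}
    {u v : ℕ → α → ℝ≥0∞} {u' v' : ℕ → ℝ≥0∞}
    (hu : ∀ n, Tendsto (u n) F (𝓝 (u' n))) (hu' : Tendsto u' atTop (𝓝 a))
    (hv : ∀ n, Tendsto (v n) F (𝓝 (v' n))) (hv' : Tendsto v' atTop (𝓝 a))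
    (huf : ∀ n, ∀ᶠ x in F, u n x ≤ f x) (hfv : ∀ n, ∀ᶠ x in F, f x ≤ v n x) :
    Tendsto f F (𝓝 a) := by
  refine tendsto_order.2 ⟨fun b hb => ?_, fun b hb => ?_⟩
  · obtain ⟨n, hn⟩ := (hu'.eventually_const_lt hb).exists
    filter_upwards [(hu n).eventually_const_lt hn, huf n] with x h1 h2 using h1.trans_le h2
  · obtain ⟨n, hn⟩ := (hv'.eventually_lt_const hb).exists
    filter_upwards [(hv n).eventually_lt_const hn, hfv n] with x h1 h2 using h2.trans_lt h1

lemma RadioModel.coverageLimit_eq {M : RadioModel} (hM : M.Admissible) (hL : 0 < M.L) {ρ γ : ℝ}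
    (hρ : 0 < ρ) (hγ : 0 < γ) :
    M.coverageLimit ρ γ =
      (nexp (ENNReal.ofReal (γ / (M.P * M.peakGain)) * ENNReal.ofReal M.PN +
        ENNReal.ofReal ρ * M.interfExponent (γ / (M.P * M.peakGain)))).toReal := by
  have hpk := hM.peakGain_pos hL
  have hP := hM.P_pos
  have hPN := hM.PN_pos
  have hs : 0 ≤ γ / (M.P * M.peakGain) := by positivity
  rw [coverageLimit, laplaceLimit, expNeg_eq_toReal_nexp, expNeg_eq_toReal_nexp,
    ← ENNReal.toReal_mul, ← nexp_add, ← mul_add, nexp_add, ENNReal.toReal_mul,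
    ← ENNReal.ofReal_mul hs, nexp_ofReal (by positivity), ENNReal.toReal_ofReal (Real.exp_pos _).le,
    interfExponent, ← mul_assoc, ← ENNReal.ofReal_mul hρ.le, mul_comm ρ]
  congr 3
  ring

namespace Network

variable {M : RadioModel} {ρ : ℝ} {Ω : ℝ → Type*} [∀ l, MeasurableSpace (Ω l)]
  {μ : ∀ l, Measure (Ω l)} [∀ l, IsProbabilityMeasure (μ l)] {X : ∀ l, Network (Ω l)}

lemma tendsto_measure_lt_sinr (hM : M.Admissible) (hL : 0 < M.L) (hρ : 0 < ρ)
    (hX : ∀ l, 0 < l → (X l).IsModel M (μ l) l ρ) {γ : ℝ} (hγ : 0 < γ) :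
    Tendsto (fun l => μ l {ω | γ < (X l).sinr M ω}) atTop
      (𝓝 (nexp (ENNReal.ofReal (γ / (M.P * M.peakGain)) * ENNReal.ofReal M.PN +
        ENNReal.ofReal ρ * M.interfExponent (γ / (M.P * M.peakGain))))) := by
  have hpk := hM.peakGain_pos hL
  -- The shift by `2` keeps `θ 0` positive.
  let θ : ℕ → ℝ := fun n => 1 - 1 / ((n : ℝ) + 2)
  have hθ0 : ∀ n, 0 < θ n := fun n => by
    have : (1 : ℝ) / (n + 2) < 1 := by
      rw [div_lt_one (by positivity)]
      have : (0 : ℝ) ≤ n := n.cast_nonneg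
      linarith
    exact sub_pos.2 this
  have hθ1 : ∀ n, θ n < 1 := fun n => sub_lt_self _ (by positivity)
  have hθmono : Monotone θ := fun m n hmn =>
    sub_le_sub_left (one_div_le_one_div_of_le (by positivity) (by simpa using hmn)) 1
  have hθlim : Tendsto θ atTop (𝓝 1) := by
    have h : Tendsto (fun n : ℕ => 1 / ((n : ℝ) + 2)) atTop (𝓝 0) :=
      tendsto_const_nhds.div_atTop (tendsto_natCast_atTop_atTop.atTop_add tendsto_const_nhds)
    simpa [θ] using tendsto_const_nhds (x := (1 : ℝ)) |>.sub h
  let t : ℕ → ℝ := fun n => θ n * M.peakGain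
  have ht0 : ∀ n, 0 < t n := fun n => mul_pos (hθ0 n) hpk
  have ht1 : ∀ n, t n < M.peakGain := fun n => mul_lt_of_lt_one_left hpk (hθ1 n)
  have htlim : Tendsto t atTop (𝓝 M.peakGain) := by simpa using hθlim.mul_const M.peakGain
  have hvol := hM.tendsto_volume_strongSet hL (t := t)
    (fun m n hmn => mul_le_mul_of_nonneg_right (hθmono hmn) hpk.le) ht0 htlim
  choose r hr p hp hnear using fun n => hM.exists_near hL (ht1 n)
  have hp1 : ∀ n, p n ∈ Set.Icc (0 : ℝ) 1 := fun n =>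
    ⟨(hp n).le, (hnear n 0 (by simpa using hr n)).1.trans (hM.prLoS_mem _ (M.le_dist3 0)).2⟩
  set s := γ / (M.P * M.peakGain)
  let Q : ℝ≥0∞ → ℝ≥0∞ := fun d => ENNReal.ofReal s * ENNReal.ofReal M.PN + d * M.interfExponent s
  let bad : ℕ → ℝ → ℝ≥0∞ := fun n l =>
    nexp (ENNReal.ofReal l * (ENNReal.ofReal (p n) * volume (Metric.ball (0 : Plane) (r n)))) +
      (1 - nexp (ENNReal.ofReal (M.activeDensity ρ l) * volume (M.strongSet (t n))))
  have hdens : Tendsto (fun l => ENNReal.ofReal (M.activeDensity ρ l)) atTop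
      (𝓝 (ENNReal.ofReal ρ)) := ENNReal.tendsto_ofReal (hM.tendsto_activeDensity ρ)
  -- The exponent may be `∞`; multiplication by it is continuous at `ρ` because `ρ ≠ 0`.
  have hQ : Tendsto (fun l => Q (ENNReal.ofReal (M.activeDensity ρ l))) atTop
      (𝓝 (Q (ENNReal.ofReal ρ))) :=
    tendsto_const_nhds.add (ENNReal.Tendsto.mul_const hdens (Or.inl (ENNReal.ofReal_pos.2 hρ).ne'))
  -- As `l → ∞` the near-BS term vanishes; what remains, an active BS in `strongSet (t n)`,
  -- disappears only as `n → ∞`.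
  have hbad : ∀ n, Tendsto (bad n) atTop
      (𝓝 (1 - nexp (ENNReal.ofReal ρ * volume (M.strongSet (t n))))) := by
    intro n
    have h0 : ENNReal.ofReal (p n) * volume (Metric.ball (0 : Plane) (r n)) ≠ 0 :=
      mul_ne_zero (ENNReal.ofReal_pos.2 (hp n)).ne' (Metric.measure_ball_pos _ _ (hr n)).ne'
    have h1 : Tendsto (fun l : ℝ => nexp (ENNReal.ofReal l *
        (ENNReal.ofReal (p n) * volume (Metric.ball (0 : Plane) (r n))))) atTop (𝓝 0) := by
      have := ENNReal.Tendsto.mul_const (b := ENNReal.ofReal (p n) *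
        volume (Metric.ball (0 : Plane) (r n))) ENNReal.tendsto_ofReal_atTop (Or.inl ENNReal.top_ne_zero)
      rw [ENNReal.top_mul h0] at this
      have h := (continuous_nexp.tendsto _).comp this
      rwa [nexp_top] at h
    have h2 : Tendsto (fun l : ℝ => 1 - nexp (ENNReal.ofReal (M.activeDensity ρ l) *
        volume (M.strongSet (t n)))) atTop
        (𝓝 (1 - nexp (ENNReal.ofReal ρ * volume (M.strongSet (t n))))) :=
      ENNReal.Tendsto.sub tendsto_const_nhds ((continuous_nexp.tendsto _).comp
        (ENNReal.Tendsto.mul_const hdens (Or.inl (ENNReal.ofReal_pos.2 hρ).ne')))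
        (Or.inl ENNReal.one_ne_top)
    have h3 := h1.add h2
    rwa [zero_add] at h3
  have hδ : Tendsto (fun n => 1 - nexp (ENNReal.ofReal ρ * volume (M.strongSet (t n)))) atTop
      (𝓝 0) := by
    have h1 := ENNReal.Tendsto.const_mul hvol (a := ENNReal.ofReal ρ) (Or.inr ENNReal.ofReal_ne_top)
    have h2 := ENNReal.Tendsto.sub (tendsto_const_nhds (x := (1 : ℝ≥0∞)))
      ((continuous_nexp.tendsto _).comp h1) (Or.inl ENNReal.one_ne_top)
    simpa [nexp_zero] using h2
  have hc : Tendsto (fun n => ENNReal.ofReal (M.peakGain / t n)) atTop (𝓝 1) := by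
    have := ENNReal.tendsto_ofReal ((tendsto_const_nhds (x := M.peakGain)).div htlim hpk.ne')
    simpa [div_self hpk.ne'] using this
  refine tendsto_of_eventually_between
    (u := fun n l => nexp (ENNReal.ofReal (M.peakGain / t n) *
      Q (ENNReal.ofReal (M.activeDensity ρ l))) - bad n l)
    (v := fun n l => nexp (Q (ENNReal.ofReal (M.activeDensity ρ l))) + bad n l)
    (fun n => ENNReal.Tendsto.sub ((continuous_nexp.tendsto _).comp
      (ENNReal.Tendsto.const_mul hQ (Or.inr ENNReal.ofReal_ne_top))) (hbad n)
      (Or.inl (nexp_ne_top _))) ?_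
    (fun n => ((continuous_nexp.tendsto _).comp hQ).add (hbad n)) ?_ ?_ ?_
  · have h1 := ENNReal.Tendsto.mul_const (b := Q (ENNReal.ofReal ρ)) hc (Or.inl one_ne_zero)
    rw [one_mul] at h1
    simpa using ENNReal.Tendsto.sub ((continuous_nexp.tendsto _).comp h1) hδ
      (Or.inl (nexp_ne_top _))
  · simpa using (tendsto_const_nhds (x := nexp (Q (ENNReal.ofReal ρ)))).add hδ
  · intro n
    filter_upwards [eventually_gt_atTop 0] with l hl
    exact (tsub_le_tsub_left ((hX l hl).measure_badEvent_le hM (ht0 n) (hp1 n)) _).trans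
      ((hX l hl).le_measure_lt_sinr hM hL (ht0 n) (ht1 n).le (hnear n) hγ)
  · intro n
    filter_upwards [eventually_gt_atTop 0] with l hl
    exact ((hX l hl).measure_lt_sinr_le hM hL (hnear n) hγ).trans
      (add_le_add_right ((hX l hl).measure_badEvent_le hM (ht0 n) (hp1 n)) _)

lemma tendsto_coverage (hM : M.Admissible) (hL : 0 < M.L) (hρ : 0 < ρ)
    (hX : ∀ l, 0 < l → (X l).IsModel M (μ l) l ρ) {γ : ℝ} (hγ : 0 < γ) :
    Tendsto (fun l => (X l).coverage M (μ l) γ) atTop (𝓝 (M.coverageLimit ρ γ)) := by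
  rw [RadioModel.coverageLimit_eq hM hL hρ hγ]
  exact (ENNReal.tendsto_toReal (nexp_ne_top _)).comp (tendsto_measure_lt_sinr hM hL hρ hX hγ)

end Network

/-! ### The mean logarithm in terms of tails. -/

section LayerCake

lemma integral_one_div_one_add {a b : ℝ} (ha : 0 ≤ a) (hab : a ≤ b) :
    ∫ t in a..b, 1 / (1 + t) = Real.log (1 + b) - Real.log (1 + a) := by
  have hpos : ∀ t ∈ Set.uIcc a b, 0 < 1 + t := fun t ht => by
    rw [Set.uIcc_of_le hab] at ht
    linarith [ht.1]
  refine intervalIntegral.integral_eq_sub_of_hasDerivAt (f := fun t => Real.log (1 + t))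
    (fun t ht => ?_) ?_
  · simpa using ((hasDerivAt_id t).const_add 1).log (hpos t ht).ne'
  · refine ContinuousOn.intervalIntegrable fun t ht => ContinuousAt.continuousWithinAt ?_
    exact continuousAt_const.div (by fun_prop) (hpos t ht).ne'

variable {ν : Measure ℝ} {c : ℝ}

/-- Layer cake with `log (1 + x) = ∫₀ˣ dt / (1 + t)` on `(a, ∞)`. For `t ≤ a` the tail of the
restricted measure is constant, which yields the boundary term. -/
lemma setLIntegral_log_one_add (a : ℝ) (ha : 0 ≤ a) :
    ∫⁻ x in Set.Ioi a, ENNReal.ofReal (Real.log (1 + x)) ∂ν =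
      ν (Set.Ioi a) * ENNReal.ofReal (Real.log (1 + a)) +
        ∫⁻ t in Set.Ioi a, ν (Set.Ioi t) * ENNReal.ofReal (1 / (1 + t)) := by
  have hint : ∀ {x y : ℝ}, 0 ≤ x → x ≤ y →
      IntervalIntegrable (fun t : ℝ => 1 / (1 + t)) volume x y := fun hx hxy => by
    refine ContinuousOn.intervalIntegrable fun t ht => ContinuousAt.continuousWithinAt ?_
    rw [Set.uIcc_of_le hxy] at ht
    exact continuousAt_const.div (by fun_prop) (by linarith [ht.1])
  have h1 := lintegral_comp_eq_lintegral_meas_lt_mul (ν.restrict (Set.Ioi a)) (f := fun x => x)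
    (g := fun t => 1 / (1 + t))
    ((ae_restrict_mem measurableSet_Ioi).mono fun x hx => ha.trans (le_of_lt hx))
    aemeasurable_id (fun t ht => hint le_rfl (le_of_lt ht))
    ((ae_restrict_mem measurableSet_Ioi).mono fun t ht =>
      div_nonneg zero_le_one (by linarith [Set.mem_Ioi.1 ht]))
  have h2 : ∫⁻ x in Set.Ioi a, ENNReal.ofReal (Real.log (1 + x)) ∂ν =
      ∫⁻ x in Set.Ioi a, ENNReal.ofReal (∫ t in (0 : ℝ)..x, 1 / (1 + t)) ∂ν :=
    setLIntegral_congr_fun measurableSet_Ioi fun x hx => by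
      rw [integral_one_div_one_add le_rfl (ha.trans (le_of_lt hx))]
      simp
  rw [h2, h1, ← Set.Ioc_union_Ioi_eq_Ioi ha, lintegral_union measurableSet_Ioi
    (Set.disjoint_left.2 fun t ht ht' => absurd ht.2 (not_le.2 ht'))]
  congr 1
  · rw [setLIntegral_congr_fun (g := fun t => ν (Set.Ioi a) * ENNReal.ofReal (1 / (1 + t)))
      measurableSet_Ioc fun t ht => ?_]
    · rw [lintegral_const_mul _ (by fun_prop), ← ofReal_integral_eq_lintegral_ofReal
        ((intervalIntegrable_iff_integrableOn_Ioc_of_le ha).1 (hint le_rfl ha))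
        ((ae_restrict_mem measurableSet_Ioc).mono fun t ht =>
          div_nonneg zero_le_one (by linarith [ht.1])),
        ← intervalIntegral.integral_of_le ha, integral_one_div_one_add le_rfl ha]
      simp
    · have : {x : ℝ | t < x} ∩ Set.Ioi a = Set.Ioi a :=
        Set.inter_eq_right.2 fun x hx => ht.2.trans_lt hx
      change ν.restrict (Set.Ioi a) (Set.Ioi t) * _ = _
      rw [Measure.restrict_apply measurableSet_Ioi]
      congr 2
  · refine setLIntegral_congr_fun measurableSet_Ioi fun t ht => ?_
    have : Set.Ioi t ∩ Set.Ioi a = Set.Ioi t :=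
      Set.inter_eq_left.2 (Set.Ioi_subset_Ioi (le_of_lt ht))
    change ν.restrict (Set.Ioi a) (Set.Ioi t) * _ = _
    rw [Measure.restrict_apply measurableSet_Ioi, this]

variable [IsProbabilityMeasure ν]

/-- Absolute continuity holds only on `(0, ∞)`, but there the derivative of the whole law agrees
with that of its restriction. -/
lemma setLIntegral_mul_rnDeriv (hν : ν.restrict (Set.Ioi 0) ≪ volume) {a : ℝ} (ha : 0 ≤ a)
    {φ : ℝ → ℝ≥0∞} (hφ : Measurable φ) :
    ∫⁻ x in Set.Ioi a, φ x * ν.rnDeriv volume x = ∫⁻ x in Set.Ioi a, φ x ∂ν := by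
  have h1 : ν.restrict (Set.Ioi a) ≪ volume :=
    (Measure.restrict_mono (Set.Ioi_subset_Ioi ha) le_rfl).absolutelyContinuous.trans hν
  rw [← Measure.withDensity_rnDeriv_eq _ _ h1,
    withDensity_congr_ae (Measure.rnDeriv_restrict ν volume measurableSet_Ioi),
    lintegral_withDensity_eq_lintegral_mul _
      ((Measure.measurable_rnDeriv _ _).indicator measurableSet_Ioi) hφ,
    ← lintegral_indicator measurableSet_Ioi]
  refine lintegral_congr fun x => ?_
  by_cases hx : x ∈ Set.Ioi a
  · simp [Set.indicator_of_mem hx, mul_comm]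
  · simp [Set.indicator_of_notMem hx]

lemma integrableOn_tail_div (hc : 0 < c) {a : ℝ} (ha : 0 ≤ a) {f : ℝ → ℝ}
    (hf : AEStronglyMeasurable f (volume.restrict (Set.Ioi a)))
    (hfc : ∀ t, 0 < t → ‖f t‖ ≤ Real.exp (-c * t)) :
    IntegrableOn (fun t => f t / (1 + t)) (Set.Ioi a) := by
  refine Integrable.mono' (integrableOn_exp_mul_Ioi (neg_neg_of_pos hc) a)
    (hf.aemeasurable.div (by fun_prop)).aestronglyMeasurable ?_
  filter_upwards [ae_restrict_mem measurableSet_Ioi] with t ht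
  have ht0 : 0 < t := ha.trans_lt ht
  rw [norm_div, Real.norm_of_nonneg (by linarith : 0 ≤ 1 + t)]
  exact (div_le_self (norm_nonneg _) (by linarith)).trans (hfc t ht0)

lemma measurable_tail (ν : Measure ℝ) [IsFiniteMeasure ν] :
    Measurable fun t => ν.real (Set.Ioi t) :=
  Antitone.measurable fun _ _ h => measureReal_mono (Set.Ioi_subset_Ioi h)

/-- The mean of `logb 2 (1 + x)` over `(a, ∞)`, for a density on the half-line, in terms of tails. -/
lemma integral_logb_mul_rnDeriv (hν : ν.restrict (Set.Ioi 0) ≪ volume) (hc : 0 < c)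
    (htail : ∀ t, 0 < t → ν.real (Set.Ioi t) ≤ Real.exp (-c * t)) {a : ℝ} (ha : 0 ≤ a) :
    IntegrableOn (fun x => Real.logb 2 (1 + x) * (ν.rnDeriv volume x).toReal) (Set.Ioi a) ∧
    ∫ x in Set.Ioi a, Real.logb 2 (1 + x) * (ν.rnDeriv volume x).toReal =
      (ν.real (Set.Ioi a) * Real.log (1 + a) + ∫ t in Set.Ioi a, ν.real (Set.Ioi t) / (1 + t)) /
        Real.log 2 := by
  have hlog : ∀ x, Real.logb 2 (1 + x) * (ν.rnDeriv volume x).toReal =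
      (Real.log 2)⁻¹ * (Real.log (1 + x) * (ν.rnDeriv volume x).toReal) := fun x => by
    rw [Real.logb]
    ring
  have hint := integrableOn_tail_div hc ha (measurable_tail ν).aestronglyMeasurable
    (fun t ht => by rw [Real.norm_of_nonneg measureReal_nonneg]; exact htail t ht)
  have hpos : ∀ t ∈ Set.Ioi a, 0 ≤ ν.real (Set.Ioi t) / (1 + t) := fun t ht =>
    div_nonneg measureReal_nonneg (by linarith [ha.trans_lt (Set.mem_Ioi.1 ht)])
  have hR : ∫⁻ t in Set.Ioi a, ν (Set.Ioi t) * ENNReal.ofReal (1 / (1 + t)) =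
      ENNReal.ofReal (∫ t in Set.Ioi a, ν.real (Set.Ioi t) / (1 + t)) := by
    rw [ofReal_integral_eq_lintegral_ofReal hint
      ((ae_restrict_mem measurableSet_Ioi).mono hpos)]
    refine lintegral_congr fun t => ?_
    rw [← ofReal_measureReal (μ := ν), ← ENNReal.ofReal_mul measureReal_nonneg, mul_one_div]
  have hloga : 0 ≤ Real.log (1 + a) := Real.log_nonneg (by linarith)
  have hI0 : 0 ≤ ∫ t in Set.Ioi a, ν.real (Set.Ioi t) / (1 + t) :=
    setIntegral_nonneg measurableSet_Ioi hpos
  have hL : ∫⁻ x in Set.Ioi a, ENNReal.ofReal (Real.log (1 + x) * (ν.rnDeriv volume x).toReal) =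
      ENNReal.ofReal (ν.real (Set.Ioi a) * Real.log (1 + a) +
        ∫ t in Set.Ioi a, ν.real (Set.Ioi t) / (1 + t)) := by
    rw [ENNReal.ofReal_add (mul_nonneg measureReal_nonneg hloga) hI0, ← hR,
      ENNReal.ofReal_mul measureReal_nonneg, ofReal_measureReal, ← setLIntegral_log_one_add a ha,
      ← setLIntegral_mul_rnDeriv hν ha (by fun_prop)]
    refine lintegral_congr_ae ?_
    filter_upwards [ae_restrict_of_ae (Measure.rnDeriv_lt_top ν volume)] with x hx
    rw [ENNReal.ofReal_mul' ENNReal.toReal_nonneg, ENNReal.ofReal_toReal hx.ne]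
  have hmeas : AEStronglyMeasurable (fun x => Real.log (1 + x) * (ν.rnDeriv volume x).toReal)
      (volume.restrict (Set.Ioi a)) := by
    have := Measure.measurable_rnDeriv ν volume
    exact Measurable.aestronglyMeasurable (by fun_prop)
  have hnn : 0 ≤ᵐ[volume.restrict (Set.Ioi a)]
      fun x => Real.log (1 + x) * (ν.rnDeriv volume x).toReal :=
    (ae_restrict_mem measurableSet_Ioi).mono fun x hx => mul_nonneg
      (Real.log_nonneg (by linarith [ha.trans_lt (Set.mem_Ioi.1 hx)])) ENNReal.toReal_nonneg
  simp only [hlog]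
  refine ⟨Integrable.const_mul ⟨hmeas, ?_⟩ _, ?_⟩
  · rw [hasFiniteIntegral_iff_ofReal hnn, hL]
    exact ENNReal.ofReal_lt_top
  · rw [integral_const_mul, integral_eq_lintegral_of_nonneg_ae hnn hmeas, hL,
      ENNReal.toReal_ofReal (add_nonneg (mul_nonneg measureReal_nonneg hloga) hI0),
      div_eq_inv_mul]

end LayerCake

/-! ### The area spectral efficiency and the conclusion. -/

namespace Network.IsModel

variable {Ω : Type*} [MeasurableSpace Ω] {X : Network Ω} {M : RadioModel} {μ : Measure Ω}
  {l ρ : ℝ}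

lemma map_sinr_real_Ioi (hX : X.IsModel M μ l ρ) (hM : M.Admissible) (γ : ℝ) :
    (μ.map (X.sinr M)).real (Set.Ioi γ) = X.coverage M μ γ := by
  rw [map_measureReal_apply (hX.isMeasurable.sinr hM) measurableSet_Ioi]
  rfl

variable [IsProbabilityMeasure μ]

/-- Even without interference, noise over the strongest possible link bounds the load below. The
bound does not depend on `l` and serves as the dominating function. -/
lemma coverage_le (hX : X.IsModel M μ l ρ) (hM : M.Admissible) (hL : 0 < M.L) {γ : ℝ}
    (hγ : 0 < γ) :
    X.coverage M μ γ ≤ Real.exp (-(M.PN / (M.P * M.peakGain)) * γ) := by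
  have hP := hM.P_pos
  have hPN := hM.PN_pos
  have hpk := hM.peakGain_pos hL
  have h : μ {ω | γ < X.sinr M ω} ≤
      ENNReal.ofReal (Real.exp (-(M.PN / (M.P * M.peakGain)) * γ)) := by
    rw [hX.measure_lt_sinr hM hL hγ, neg_mul, ← nexp_ofReal (by positivity)]
    refine (lintegral_mono (g := fun _ => nexp (ENNReal.ofReal (M.PN / (M.P * M.peakGain) * γ)))
      fun ω => ?_).trans (by simp)
    refine nexp_antitone ?_
    rw [mul_comm, ENNReal.ofReal_mul hγ.le]
    gcongr
    exact le_load hM hL ω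
  exact ENNReal.toReal_le_of_le_ofReal (Real.exp_pos _).le h

lemma integral_rateDensity (hX : X.IsModel M μ l ρ) (hM : M.Admissible) (hL : 0 < M.L) {γ₀ : ℝ}
    (hγ₀ : 0 ≤ γ₀) :
    IntegrableOn (X.rateDensity M μ) (Set.Ioi γ₀) ∧
    ∫ γ in Set.Ioi γ₀, X.rateDensity M μ γ =
      (X.coverage M μ γ₀ * Real.log (1 + γ₀) + ∫ γ in Set.Ioi γ₀, X.coverage M μ γ / (1 + γ)) /
        Real.log 2 := by
  have := Measure.isProbabilityMeasure_map (μ := μ) (hX.isMeasurable.sinr hM).aemeasurable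
  have h := integral_logb_mul_rnDeriv (hX.map_sinr_restrict_absolutelyContinuous hM hL)
    (div_pos hM.PN_pos (mul_pos hM.P_pos (hM.peakGain_pos hL)))
    (fun t ht => by rw [hX.map_sinr_real_Ioi hM]; exact hX.coverage_le hM hL ht) hγ₀
  simp only [hX.map_sinr_real_Ioi hM] at h
  exact h

end Network.IsModel

theorem theorem3
    (M : RadioModel) (hM : M.Admissible) (hL : 0 < M.L)
    (ρ : ℝ) (hρ : 0 < ρ) (γ₀ : ℝ) (hγ₀ : 0 ≤ γ₀)
    {Ω : ℝ → Type*} [∀ l, MeasurableSpace (Ω l)]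
    (μ : ∀ l, Measure (Ω l)) [∀ l, IsProbabilityMeasure (μ l)]
    (X : ∀ l, Network (Ω l)) (hX : ∀ l, 0 < l → (X l).IsModel M (μ l) l ρ) :
    Tendsto (fun l => M.activeDensity ρ l) atTop (𝓝 ρ) ∧
    (∀ γ, 0 < γ →
      Tendsto (fun l => (X l).coverage M (μ l) γ) atTop (𝓝 (M.coverageLimit ρ γ))) ∧
    (∀ l, 0 < l → IntegrableOn ((X l).rateDensity M (μ l)) (Set.Ioi γ₀)) ∧
    IntegrableOn (fun γ => M.coverageLimit ρ γ / (1 + γ)) (Set.Ioi γ₀) ∧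
    Tendsto (fun l => (X l).ase M (μ l) l ρ γ₀) atTop
      (𝓝 (ρ / Real.log 2 * (∫ γ in Set.Ioi γ₀, M.coverageLimit ρ γ / (1 + γ)) +
        ρ * Real.logb 2 (1 + γ₀) * M.coverageLimit ρ γ₀)) := by
  have hdens := hM.tendsto_activeDensity ρ
  have hcov : ∀ γ, 0 < γ → Tendsto (fun l => (X l).coverage M (μ l) γ) atTop
      (𝓝 (M.coverageLimit ρ γ)) := fun γ hγ => Network.tendsto_coverage hM hL hρ hX hγ
  set c := M.PN / (M.P * M.peakGain)
  have hc : 0 < c := div_pos hM.PN_pos (mul_pos hM.P_pos (hM.peakGain_pos hL))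
  have hmeas : ∀ l, 0 < l → AEStronglyMeasurable (fun γ => (X l).coverage M (μ l) γ)
      (volume.restrict (Set.Ioi γ₀)) := fun l hl => by
    have := Measure.isProbabilityMeasure_map (μ := μ l) ((hX l hl).isMeasurable.sinr hM).aemeasurable
    simp only [← (hX l hl).map_sinr_real_Ioi hM]
    exact (measurable_tail _).aestronglyMeasurable
  have hbound : ∀ l, 0 < l → ∀ γ, 0 < γ → ‖(X l).coverage M (μ l) γ‖ ≤ Real.exp (-c * γ) :=
    fun l hl γ hγ => by
      rw [Network.coverage, Real.norm_of_nonneg measureReal_nonneg]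
      exact (hX l hl).coverage_le hM hL hγ
  -- Measurability and the exponential bound are inherited from the coverage probabilities through
  -- the pointwise limit; `n + 1` keeps the density positive.
  have hmeas' : AEStronglyMeasurable (M.coverageLimit ρ) (volume.restrict (Set.Ioi γ₀)) := by
    refine aestronglyMeasurable_of_tendsto_ae atTop
      (f := fun (n : ℕ) γ => (X ((n : ℝ) + 1)).coverage M (μ (n + 1)) γ)
      (fun n => hmeas _ (by positivity)) ?_
    filter_upwards [ae_restrict_mem measurableSet_Ioi] with γ hγ
    exact (hcov γ (hγ₀.trans_lt hγ)).comp
      (tendsto_natCast_atTop_atTop.atTop_add tendsto_const_nhds)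
  have hbound' : ∀ γ, 0 < γ → ‖M.coverageLimit ρ γ‖ ≤ Real.exp (-c * γ) := fun γ hγ =>
    le_of_tendsto (hcov γ hγ).norm ((eventually_gt_atTop 0).mono fun l hl => hbound l hl γ hγ)
  refine ⟨hdens, hcov, fun l hl => ((hX l hl).integral_rateDensity hM hL hγ₀).1,
    integrableOn_tail_div hc hγ₀ hmeas' hbound', ?_⟩
  have hint : Tendsto (fun l => ∫ γ in Set.Ioi γ₀, (X l).coverage M (μ l) γ / (1 + γ)) atTop
      (𝓝 (∫ γ in Set.Ioi γ₀, M.coverageLimit ρ γ / (1 + γ))) := by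
    refine tendsto_integral_filter_of_dominated_convergence (fun γ => Real.exp (-c * γ)) ?_ ?_
      (integrableOn_exp_mul_Ioi (neg_neg_of_pos hc) γ₀) ?_
    · filter_upwards [eventually_gt_atTop 0] with l hl
      exact ((hmeas l hl).aemeasurable.div (by fun_prop)).aestronglyMeasurable
    · filter_upwards [eventually_gt_atTop 0] with l hl
      filter_upwards [ae_restrict_mem measurableSet_Ioi] with γ hγ
      have hγ0 : 0 < γ := hγ₀.trans_lt hγ
      rw [norm_div, Real.norm_of_nonneg (by linarith : 0 ≤ 1 + γ)]
      exact (div_le_self (norm_nonneg _) (by linarith)).trans (hbound l hl γ hγ0)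
    · filter_upwards [ae_restrict_mem measurableSet_Ioi] with γ hγ
      exact (hcov γ (hγ₀.trans_lt hγ)).div_const _
  have hedge : Tendsto (fun l => (X l).coverage M (μ l) γ₀ * Real.log (1 + γ₀)) atTop
      (𝓝 (M.coverageLimit ρ γ₀ * Real.log (1 + γ₀))) := by
    -- Convergence of coverage is available only for `γ > 0`; at `γ₀ = 0` the factor `log 1 = 0`
    -- removes the term.
    rcases hγ₀.eq_or_lt with rfl | h
    · simp
    · exact (hcov γ₀ h).mul_const _
  have hlim := hdens.mul ((hedge.add hint).div_const (Real.log 2))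
  have hval : ρ * ((M.coverageLimit ρ γ₀ * Real.log (1 + γ₀) +
        ∫ γ in Set.Ioi γ₀, M.coverageLimit ρ γ / (1 + γ)) / Real.log 2) =
      ρ / Real.log 2 * (∫ γ in Set.Ioi γ₀, M.coverageLimit ρ γ / (1 + γ)) +
        ρ * Real.logb 2 (1 + γ₀) * M.coverageLimit ρ γ₀ := by
    rw [Real.logb]
    ring
  rw [hval] at hlim
  refine hlim.congr' ?_
  filter_upwards [eventually_gt_atTop 0] with l hl
  rw [Network.ase, ((hX l hl).integral_rateDensity hM hL hγ₀).2]
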